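/- Let $P,X,Y,E$ be finite-dimensional Euclidean spaces, $Z:=P\times X$, let $g\colon Z\to Y$ be a mapping, let $C\subset Y$ be a closed set, and put $\Gamma(p):=\{x\in X\mid g(p,x)\in C\}$ for $p\in P$. Fix $\bar z=(\bar p,\bar x)$ with $g(\bar z)\in C$. **Notation.** For a subset $\Omega$ of a finite-dimensional normed space $W$ and $w\in\Omega$, $T_\Omega(w)$ is the Bouligand tangent (contingent) cone, i.e. the set of all $d=\lim_k d_k$ such that $w+t_kd_k\in\Omega$ for all $k$ with some $t_k\downarrow0$. The symbol $N_\Omega(w)\subset W^*$ denotes a fixed one of the following three normal cones (the theorem holds for each choice, the same choice being used throughout): the regular normal cone $\{w^*\mid\limsup_{w'\to w,\,w'\in\Omega}\langle w^*,w'-w\rangle/\|w'-w\|\le0\}$; the limiting normal cone, which consists of all limits $\lim_kw_k^*$ of regular normals $w_k^*$ to $\Omega$ at points $w_k\in\Omega$ with $w_k\to w$; the convexified normal cone, which is the closed convex hull of the limiting one. We put $N_\Omega(w):=\emptyset$ for $w\notin\Omega$. The critical cone is $\mathcal K_\Omega(w,w^*):=T_\Omega(w)\cap\{d\mid\langle w^*,d\rangle=0\}$.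 The dual cone of a cone $K$ is $K^*:=\{\mu\mid\langle\mu,e\rangle\le0\ \text{for all}\ e\in K\}$, and ${\rm lin}\,K:=K\cap(-K)$. Let $\Psi(p,x):=N_{\Gamma(p)}(x)$, let $\pi_{X^*}\colon P^*\times X^*\to X^*$, $\pi_{X^*}(p^*,x^*):=x^*$, and for a set-valued mapping $F$ let ${\rm gph}\,F$ be its graph and $DF(w,u)(d):=\{u'\mid(d,u')\in T_{{\rm gph}\,F}(w,u)\}$ its graphical derivative. **Assumptions.** (a) $g$ is $C^2$-smooth around $\bar z$. (b) $C$ is $C^2$-reducible at $g(\bar z)$ to a closed convex cone $K\subset E$: there are an open neighborhood $V$ of $g(\bar z)$ and a $C^2$ mapping $h\colon V\to E$ such that $h(g(\bar z))=0$, $\nabla h(g(\bar z))$ is surjective, and $C\cap V=\{y\in V\mid h(y)\in K\}$. Put $G:=h\circ g$ near $\bar z$. (c) $\bar x^*\in N_{\Gamma(\bar p)}(\bar x)$. (d) The reduced system $G(p,x)\in K$ enjoys Robinson stability at $\bar z$: there is $\kappa\ge0$ such that ${\rm dist}\big(x;\{x'\mid G(p,x')\in K\}\big)\le\kappa\,{\rm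 dist}\big(G(p,x);K\big)$ for all $(p,x)$ close to $\bar z$, where the distance to the empty set is $+\infty$. (e) Either $\mathcal P=P$, where $\mathcal P:=\{q\in P\mid\nabla_pG(\bar z)q\in{\rm rge}\,\nabla_xG(\bar z)+{\rm lin}\,K\}$, or $K$ is polyhedral. For $z^*\in Z^*$ and $v\in Z$ put $\mathcal M(\bar z,z^*):=\{\mu\in K^*\mid\nabla G(\bar z)^*\mu=z^*\}$ and let $\mathcal M(\bar z,z^*;v)$ be the set of maximizers of $\mu\mapsto\langle\mu,\nabla^2G(\bar z)(v,v)\rangle$ over $\mathcal M(\bar z,z^*)$. **Theorem.** Under (a)–(e), $$\begin{aligned}T_{{\rm gph}\,\Psi}(\bar p,\bar x,\bar x^*)=\Big\{(q,u,u^*)\ \Big|\ &\exists\,z^*\in N_{T_{{\rm gph}\,\Gamma}(\bar z)}(q,u)\cap\pi_{X^*}^{-1}(\bar x^*),\ \exists\,\hat\mu\in\mathcal M\big(\bar z,z^*;(q,u)\big):\\ &u^*\in\nabla\big(\nabla_xG(\cdot)^*\hat\mu\big)(\bar z)(q,u)+\pi_{X^*}\big(N_{\mathcal K_{{\rm gph}\,\Gamma}(\bar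 z,z^*)}(q,u)\big)\Big\},\end{aligned}$$ and consequently, for all $v=(q,u)\in Z$, $$D\Psi(\bar p,\bar x,\bar x^*)(v)=\bigcup_{z^*\in N_{T_{{\rm gph}\,\Gamma}(\bar z)}(v)\cap\pi_{X^*}^{-1}(\bar x^*)}\ \bigcup_{\hat\mu\in\mathcal M(\bar z,z^*;v)}\Big(\nabla\big(\nabla_xG(\cdot)^*\hat\mu\big)(\bar z)v+\pi_{X^*}\big(N_{\mathcal K_{{\rm gph}\,\Gamma}(\bar z,z^*)}(v)\big)\Big).$$ -/

import Mathlib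

open Filter Topology Set
open scoped NNReal ENNReal

noncomputable section

/-! ### Tangent and normal cones, critical cone, graphical derivative -/

/-- The (Bouligand-Severi) tangent cone to `Ω` at `z ∈ Ω`: all limits `w` of sequences `w k` with
`z + t k • w k ∈ Ω` for some `t k ↓ 0`. It is empty for `z ∉ Ω`. -/
def bouligandTangentCone {Z : Type*} [NormedAddCommGroup Z] [NormedSpace ℝ Z]
    (Ω : Set Z) (z : Z) : Set Z :=
  {w | z ∈ Ω ∧ ∃ (t : ℕ → ℝ) (wk : ℕ → Z), (∀ k, 0 < t k) ∧ Tendsto t atTop (𝓝 0) ∧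
    Tendsto wk atTop (𝓝 w) ∧ ∀ k, z + t k • wk k ∈ Ω}

/-- The (Fréchet) regular normal cone to `Ω` at `z ∈ Ω`: the functionals `zs` such that the upper
limit of `zs (y - z) / ‖y - z‖`, as `y → z` in `Ω`, is nonpositive. It is empty for `z ∉ Ω`. -/
def regularNormalCone {Z : Type*} [NormedAddCommGroup Z] [NormedSpace ℝ Z]
    (Ω : Set Z) (z : Z) : Set (StrongDual ℝ Z) :=
  {zs | z ∈ Ω ∧ ∀ ε : ℝ, 0 < ε → ∀ᶠ y in 𝓝[Ω] z, zs (y - z) ≤ ε * ‖y - z‖}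

/-- The (Mordukhovich) limiting normal cone to `Ω` at `z ∈ Ω`. It is empty for `z ∉ Ω`. -/
def limitingNormalCone {Z : Type*} [NormedAddCommGroup Z] [NormedSpace ℝ Z]
    (Ω : Set Z) (z : Z) : Set (StrongDual ℝ Z) :=
  {zs | z ∈ Ω ∧ ∃ (y : ℕ → Z) (ys : ℕ → StrongDual ℝ Z), (∀ k, y k ∈ Ω) ∧
    Tendsto y atTop (𝓝 z) ∧ (∀ k, ys k ∈ regularNormalCone Ω (y k)) ∧
    Tendsto ys atTop (𝓝 zs)}

/-- The (Clarke) convexified normal cone: the closed convex hull of the limiting normal cone. -/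
def convexifiedNormalCone {Z : Type*} [NormedAddCommGroup Z] [NormedSpace ℝ Z]
    (Ω : Set Z) (z : Z) : Set (StrongDual ℝ Z) :=
  closure (convexHull ℝ (limitingNormalCone Ω z))

/-- The three major normal cones of variational analysis. -/
inductive NormalConeKind
  | regular
  | limiting
  | convexified

/-- The normal cone of the given kind to `Ω` at `z`; the generic symbol `N_Ω(z)`. -/
def normalCone {Z : Type*} [NormedAddCommGroup Z] [NormedSpace ℝ Z]
    (N : NormalConeKind) (Ω : Set Z) (z : Z) : Set (StrongDual ℝ Z) :=
  match N with
  | .regular => regularNormalCone Ω z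
  | .limiting => limitingNormalCone Ω z
  | .convexified => convexifiedNormalCone Ω z

/-- The critical cone `T_Ω(z) ∩ {zs}^⊥` to `Ω` at `(z, zs)`. -/
def criticalCone {Z : Type*} [NormedAddCommGroup Z] [NormedSpace ℝ Z]
    (Ω : Set Z) (z : Z) (zs : StrongDual ℝ Z) : Set Z :=
  bouligandTangentCone Ω z ∩ {w | zs w = 0}

/-- The graph of a set-valued mapping. -/
def setValuedGraph {A B : Type*} (F : A → Set B) : Set (A × B) :=
  {w | w.2 ∈ F w.1}

/-- The graphical derivative `DF(z, u)` of the set-valued mapping `F`, evaluated at `w`. -/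
def graphicalDerivative {Z U : Type*} [NormedAddCommGroup Z] [NormedSpace ℝ Z]
    [NormedAddCommGroup U] [NormedSpace ℝ U]
    (F : Z → Set U) (z : Z) (u : U) (w : Z) : Set U :=
  {v | (w, v) ∈ bouligandTangentCone (setValuedGraph F) (z, u)}

/-! ### Cones, reducibility and Robinson stability -/

/-- The dual cone `K^*` (the functionals that are nonpositive on `K`). -/
def polarCone {E : Type*} [NormedAddCommGroup E] [NormedSpace ℝ E]
    (K : Set E) : Set (StrongDual ℝ E) :=
  {μ | ∀ e ∈ K, μ e ≤ 0}

/-- A set is polyhedral if it is the intersection of finitely many closed half-spaces. -/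
def IsPolyhedralSet {E : Type*} [NormedAddCommGroup E] [NormedSpace ℝ E] (S : Set E) : Prop :=
  ∃ s : Finset (StrongDual ℝ E × ℝ), S = {e | ∀ c ∈ s, c.1 e ≤ c.2}

/-- The closed set `C` is `C²`-reducible at `y ∈ C` to the closed convex cone `K`, by the mapping
`h` defined on the neighborhood `V` of `y`. The values of `h` outside of `V` are irrelevant. -/
structure IsC2ConeReduction {Y E : Type*} [NormedAddCommGroup Y] [NormedSpace ℝ Y]
    [NormedAddCommGroup E] [NormedSpace ℝ E]
    (C : Set Y) (y : Y) (K : ProperCone ℝ E) (V : Set Y) (h : Y → E) : Prop where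
  isClosed : IsClosed C
  mem : y ∈ C
  isOpen_nhd : IsOpen V
  mem_nhd : y ∈ V
  contDiffOn : ContDiffOn ℝ 2 h V
  map_eq_zero : h y = 0
  surjective : Function.Surjective (fderiv ℝ h y)
  inter_eq : C ∩ V = {y' ∈ V | h y' ∈ K}

/-- Robinson stability of the system `f (p, x) ∈ D` at `(p, x) = z`:
`dist(x; {x | f (p, x) ∈ D}) ≤ κ dist(f (p, x); D)` for all `(p, x)` near `z`, where the distance
to the empty set is infinite. Only the values of `f` near `z` matter when `f` is continuous at `z`
and `f z ∈ D`, since the right-hand side is then small. -/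
def RobinsonStable {P X F : Type*} [NormedAddCommGroup P] [NormedAddCommGroup X]
    [NormedAddCommGroup F] (f : P × X → F) (D : Set F) (z : P × X) : Prop :=
  ∃ κ : ℝ≥0, ∀ᶠ y in 𝓝 z,
    Metric.infEDist y.2 {x | f (y.1, x) ∈ D} ≤ (κ : ℝ≥0∞) * Metric.infEDist (f y) D

/-! ### The parametric constraint system and its second-order objects -/

/-- The solution map `Γ` of the parametric constraint system `g (p, x) ∈ C`. -/
def solutionMap {P X Y : Type*} (g : P × X → Y) (C : Set Y) : P → Set X :=
  fun p => {x | g (p, x) ∈ C}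

/-- The normal cone mapping `Ψ(p, x) = N_{Γ(p)}(x)` (with empty values for `x ∉ Γ(p)`). -/
def normalConeMapping {P X : Type*} [NormedAddCommGroup X] [NormedSpace ℝ X]
    (N : NormalConeKind) (Γ : P → Set X) : P × X → Set (StrongDual ℝ X) :=
  fun z => normalCone N (Γ z.1) z.2

/-- The product projection `π_{X^*} : P^* × X^* → X^*`, where `(P × X)^*` is identified with
`P^* × X^*`. -/
def dualProj {P X : Type*} [NormedAddCommGroup P] [NormedSpace ℝ P]
    [NormedAddCommGroup X] [NormedSpace ℝ X]
    (zs : StrongDual ℝ (P × X)) : StrongDual ℝ X :=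
  zs.comp (ContinuousLinearMap.inr ℝ P X)

/-- The partial derivative `∇_p G(z)`. -/
def partialP {P X E : Type*} [NormedAddCommGroup P] [NormedSpace ℝ P]
    [NormedAddCommGroup X] [NormedSpace ℝ X] [NormedAddCommGroup E] [NormedSpace ℝ E]
    (G : P × X → E) (z : P × X) : P →L[ℝ] E :=
  fderiv ℝ (fun p => G (p, z.2)) z.1

/-- The partial derivative `∇_x G(z)`. -/
def partialX {P X E : Type*} [NormedAddCommGroup P] [NormedSpace ℝ P]
    [NormedAddCommGroup X] [NormedSpace ℝ X] [NormedAddCommGroup E] [NormedSpace ℝ E]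
    (G : P × X → E) (z : P × X) : X →L[ℝ] E :=
  fderiv ℝ (fun x => G (z.1, x)) z.2

/-- The characteristic subspace of the parameter space: all `q` with
`∇_p G(z) q ∈ rge ∇_x G(z) + lin K`, where `lin K` is the lineality space of `K`. -/
def characteristicSubspace {P X E : Type*} [NormedAddCommGroup P] [NormedSpace ℝ P]
    [NormedAddCommGroup X] [NormedSpace ℝ X] [NormedAddCommGroup E] [NormedSpace ℝ E]
    (G : P × X → E) (K : ProperCone ℝ E) (z : P × X) : Set P :=
  {q | ∃ u : X, ∃ e ∈ (K : PointedCone ℝ E).lineal, partialP G z q = partialX G z u + e}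

/-- The mapping `∇_x G(·)^* μ` from `Z = P × X` to `X^*`. -/
def partialXAdjoint {P X E : Type*} [NormedAddCommGroup P] [NormedSpace ℝ P]
    [NormedAddCommGroup X] [NormedSpace ℝ X] [NormedAddCommGroup E] [NormedSpace ℝ E]
    (G : P × X → E) (μ : StrongDual ℝ E) : P × X → StrongDual ℝ X :=
  fun z => μ.comp (partialX G z)

/-- The multiplier set `𝓜(z, zs)`: all `μ ∈ K^*` with `∇G(z)^* μ = zs`. -/
def multiplierSet {Z E : Type*} [NormedAddCommGroup Z] [NormedSpace ℝ Z]
    [NormedAddCommGroup E] [NormedSpace ℝ E]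
    (G : Z → E) (K : Set E) (z : Z) (zs : StrongDual ℝ Z) : Set (StrongDual ℝ E) :=
  {μ | μ ∈ polarCone K ∧ μ.comp (fderiv ℝ G z) = zs}

/-- The directional multiplier set `𝓜(z, zs; v)`: the maximizers of `⟨μ, ∇²G(z)(v, v)⟩` over
`μ ∈ 𝓜(z, zs)`. -/
def directionalMultiplierSet {Z E : Type*} [NormedAddCommGroup Z] [NormedSpace ℝ Z]
    [NormedAddCommGroup E] [NormedSpace ℝ E]
    (G : Z → E) (K : Set E) (z : Z) (zs : StrongDual ℝ Z) (v : Z) : Set (StrongDual ℝ E) :=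
  {μ | μ ∈ multiplierSet G K z zs ∧ ∀ μ' ∈ multiplierSet G K z zs,
    μ' (fderiv ℝ (fderiv ℝ G) z v v) ≤ μ (fderiv ℝ (fderiv ℝ G) z v v)}

end

/-! Locally `gph Γ` is the solution set of G(p,x) ∈ K with G(z) = 0, and Robinson stability makes
the linearization exact: the tangent cone to `gph Γ` is A⁻¹(K) with A = ∇G(z). It also makes every
normal to Γ(p) near z, of whichever kind, equal to ∇ₓG*μ with μ ∈ K*, μ(G) = 0 and a norm bound on μ
(`IsStableConicSystem.exists_multiplier`). The three normal cones therefore agree near z.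

Upper estimate. A tangent to the graph of Ψ yields bounded multipliers μ_k at points z + t_k w_k
with w_k → v. Along a subsequence μ_k → μ₀, and u* minus the derivative of ∇ₓG(·)*μ₀ along v is the
limit of t_k⁻¹ ∇ₓG(z)*(μ_k − μ₀). Expanding μ_k(G) = 0 ≥ μ'(G) to second order compares μ₀ with any
competing multiplier μ'. The difficulty is that only the X-part of the quotients is known to
converge. If the characteristic subspace is everything, the P-part is a linear image of the X-part
(`conclusion_of_factor`). If K is polyhedral, a subsequence has a constant active set, all μ_k lie
in one finitely generated face, and closedness of such cones produces the normal
(`conclusion_of_polyhedral`).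

Lower estimate. Maximality of μ₀ means, by asymptotic conic duality (`exists_approx_dual_solution`),
that some w almost satisfies Aw + ∇²G(v,v) ∈ K with duality gap ε. Stability places points of Γ near
z + tv + (t²/2)w. Minimizing −⟨x* + tu*, x − c⟩ + (ρ/2)‖x − c‖² over Γ(p_t) near z, where p_t = z.1
+ t(v.1 + (t/2)w.1) and c = z.2 + t v.2, gives a point c + td carrying the normal x* + t(u* − ρd).
Comparison with the recovered points shows that limits of d as t ↓ 0 satisfy ‖d‖² ≤ Cε, with C and ρ
independent of ε. Letting ε → 0 and using closedness of the tangent cone finishes the proof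
(`exists_approx_tangent`, `IsStableConicSystem.mem_tangentCone`). -/

/-! ### First- and second-order expansions along converging directions. -/

section Calculus

variable {Z F : Type*} [NormedAddCommGroup Z] [NormedSpace ℝ Z]
  [NormedAddCommGroup F] [NormedSpace ℝ F]

theorem tendsto_clm_apply {ι : Type*} {l : Filter ι} {L : ι → Z →L[ℝ] F} {L₀ : Z →L[ℝ] F}
    {w : ι → Z} {v : Z} (hL : Tendsto L l (𝓝 L₀)) (hw : Tendsto w l (𝓝 v)) :
    Tendsto (fun i => L i (w i)) l (𝓝 (L₀ v)) :=
  (isBoundedBilinearMap_apply.continuous.tendsto (L₀, v)).comp (hL.prodMk_nhds hw)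

/-- Second-order Taylor expansion with Peano remainder. -/
theorem ContDiffAt.taylor_two_isLittleO {G : Z → F} {z : Z} (hG : ContDiffAt ℝ 2 G z) :
    (fun y => G y - G z - fderiv ℝ G z (y - z)
      - (1 / 2 : ℝ) • fderiv ℝ (fderiv ℝ G) z (y - z) (y - z)) =o[𝓝 z]
      fun y => ‖y - z‖ ^ 2 := by
  have hd2 : HasFDerivAt (fderiv ℝ G) (fderiv ℝ (fderiv ℝ G) z) z :=
    ((hG.fderiv_right (m := 1) (by norm_num)).differentiableAt (by simp)).hasFDerivAt
  have hsym : IsSymmSndFDerivAt ℝ G z := hG.isSymmSndFDerivAt (by simp)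
  have hdiff : ∀ᶠ y in 𝓝 z, DifferentiableAt ℝ G y := by
    filter_upwards [hG.eventually (by simp)] with y hy using hy.differentiableAt (by simp)
  refine Asymptotics.isLittleO_iff.2 fun ε hε => ?_
  have hlo := Asymptotics.isLittleO_iff.1 hd2.isLittleO hε
  obtain ⟨δ, hδ, hball⟩ := Metric.eventually_nhds_iff_ball.1 (hdiff.and hlo)
  filter_upwards [Metric.ball_mem_nhds z hδ] with y hy
  set r : Z → F := fun y => G y - G z - fderiv ℝ G z (y - z)
      - (1 / 2 : ℝ) • fderiv ℝ (fderiv ℝ G) z (y - z) (y - z) with hr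
  have hsub : Metric.closedBall z ‖y - z‖ ⊆ Metric.ball z δ := by
    refine Metric.closedBall_subset_ball ?_
    rwa [Metric.mem_ball, dist_eq_norm] at hy
  -- The derivative of `r` is the first-order remainder of `fderiv ℝ G`, because symmetry of the
  -- second derivative merges the two product-rule terms. The mean value inequality on the ball then
  -- gains the second factor ‖y − z‖.
  have hder : ∀ w ∈ Metric.closedBall z ‖y - z‖,
      HasFDerivWithinAt r (fderiv ℝ G w - fderiv ℝ G z - fderiv ℝ (fderiv ℝ G) z (w - z))
        (Metric.closedBall z ‖y - z‖) w := by
    intro w hw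
    have h1 : HasFDerivAt G (fderiv ℝ G w) w := (hball w (hsub hw)).1.hasFDerivAt
    have hid : HasFDerivAt (fun w : Z => w - z) (ContinuousLinearMap.id ℝ Z) w :=
      (hasFDerivAt_id w).sub_const z
    have h2 : HasFDerivAt (fun w => fderiv ℝ G z (w - z)) (fderiv ℝ G z) w := 
      (fderiv ℝ G z).hasFDerivAt.comp w hid
    have h3 : HasFDerivAt (fun w => fderiv ℝ (fderiv ℝ G) z (w - z))
        (fderiv ℝ (fderiv ℝ G) z) w := 
      (fderiv ℝ (fderiv ℝ G) z).hasFDerivAt.comp w hid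
    have h4 := (h3.clm_apply hid).const_smul (1 / 2 : ℝ)
    have h5 := (((h1.sub_const (G z)).sub h2).sub h4).hasFDerivWithinAt
      (s := Metric.closedBall z ‖y - z‖)
    refine h5.congr_fderiv ?_
    ext e
    have hs := hsym e (w - z)
    simp only [sub_apply, smul_apply,
      add_apply, ContinuousLinearMap.comp_apply,
      ContinuousLinearMap.flip_apply, ContinuousLinearMap.id_apply, hs, sub_right_inj]
    rw [← two_smul ℝ, smul_smul]
    norm_num
  have hb : ∀ w ∈ Metric.closedBall z ‖y - z‖,
      ‖fderiv ℝ G w - fderiv ℝ G z - fderiv ℝ (fderiv ℝ G) z (w - z)‖ ≤ ε * ‖y - z‖ := by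
    intro w hw
    refine (hball w (hsub hw)).2.trans ?_
    gcongr
    rwa [Metric.mem_closedBall, dist_eq_norm] at hw
  have := (convex_closedBall z ‖y - z‖).norm_image_sub_le_of_norm_hasFDerivWithin_le hder hb
    (Metric.mem_closedBall_self (norm_nonneg _))
    (show y ∈ Metric.closedBall z ‖y - z‖ by simp [dist_eq_norm])
  have hrz : r z = 0 := by simp [hr]
  rw [hrz, sub_zero] at this
  calc ‖r y‖ ≤ ε * ‖y - z‖ * ‖y - z‖ := this
    _ = ε * ‖‖y - z‖ ^ 2‖ := by rw [Real.norm_of_nonneg (by positivity)]; ring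

/-- The second-order difference quotients converge to half of the second derivative. -/
theorem ContDiffAt.tendsto_second_order_quotient {G : Z → F} {z : Z} (hG : ContDiffAt ℝ 2 G z)
    {ι : Type*} {l : Filter ι} {t : ι → ℝ} {w : ι → Z} {v : Z} 
    (ht : ∀ᶠ i in l, 0 < t i)
    (ht0 : Tendsto t l (𝓝 0)) (hw : Tendsto w l (𝓝 v)) :
    Tendsto (fun i => (t i ^ 2)⁻¹ • (G (z + t i • w i) - G z - t i • fderiv ℝ G z (w i))) l
      (𝓝 ((1 / 2 : ℝ) • fderiv ℝ (fderiv ℝ G) z v v)) := by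
  have harg : Tendsto (fun i => z + t i • w i) l (𝓝 z) := by
    simpa using tendsto_const_nhds.add (ht0.smul hw)
  have h1 := hG.taylor_two_isLittleO.comp_tendsto harg
  have h2 : (fun i => ‖z + t i • w i - z‖ ^ 2) =O[l] fun i => t i ^ 2 := by
    have : (fun i => ‖w i‖) =O[l] fun _ => (1 : ℝ) := hw.norm.isBigO_one ℝ
    have h3 := ((Asymptotics.isBigO_refl t l).mul this).pow 2
    refine (Asymptotics.isBigO_of_le l fun i => ?_).trans (by simpa using h3)
    simp [norm_smul, mul_pow]
  have h3 := (h1.trans_isBigO h2).tendsto_inv_smul_nhds_zero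
  have h4 : Tendsto (fun i => (1 / 2 : ℝ) • fderiv ℝ (fderiv ℝ G) z (w i) (w i)) l
      (𝓝 ((1 / 2 : ℝ) • fderiv ℝ (fderiv ℝ G) z v v)) := by
    refine Tendsto.const_smul ?_ _
    exact tendsto_clm_apply (((fderiv ℝ (fderiv ℝ G) z).continuous.tendsto v).comp hw) hw
  have h5 := h3.add h4
  rw [zero_add] at h5
  refine h5.congr' ?_
  filter_upwards [ht] with i hi
  simp only [Function.comp, add_sub_cancel_left, map_smul, smul_apply,
    smul_sub, smul_smul]
  have : (t i ^ 2)⁻¹ * (1 / 2 * (t i * t i)) = 1 / 2 := by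
    have := hi.ne'
    field_simp
  rw [this]
  abel

/-- The first-order difference quotients along a converging direction. -/
theorem HasFDerivAt.tendsto_quotient {G : Z → F} {z : Z} {A : Z →L[ℝ] F}
    (hG : HasFDerivAt G A z) {ι : Type*} {l : Filter ι} {t : ι → ℝ} {w : ι → Z} {v : Z}
    (ht : ∀ i, 0 < t i) (ht0 : Tendsto t l (𝓝 0)) (hw : Tendsto w l (𝓝 v)) :
    Tendsto (fun i => (t i)⁻¹ • (G (z + t i • w i) - G z)) l (𝓝 (A v)) := by
  refine (hasFDerivWithinAt_univ.2 hG).lim (by simpa using ht0.smul hw)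
    (.of_forall fun _ => mem_univ _) ?_
  refine hw.congr fun i => ?_
  rw [smul_smul, inv_mul_cancel₀ (ht i).ne', one_smul]

/-- Crude bounds for the second-order remainder and the second derivative. -/
theorem ContDiffAt.exists_eventually_norm_sub_le_sq {G : Z → F} {z : Z}
    (hG : ContDiffAt ℝ 2 G z) : ∃ M : ℝ, 0 ≤ M ∧ (∀ᶠ y in 𝓝 z,
      ‖G y - G z - fderiv ℝ G z (y - z)‖ ≤ M * ‖y - z‖ ^ 2) ∧
      ∀ y, ‖fderiv ℝ (fderiv ℝ G) z y y‖ ≤ M * ‖y‖ ^ 2 := by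
  refine ⟨1 + ‖fderiv ℝ (fderiv ℝ G) z‖, by positivity, ?_, fun y => ?_⟩
  swap
  · have := (fderiv ℝ (fderiv ℝ G) z).le_opNorm₂ y y
    nlinarith [sq_nonneg ‖y‖]
  have h := Asymptotics.isLittleO_iff.1 hG.taylor_two_isLittleO (c := 1) one_pos
  filter_upwards [h] with y hy
  set q := (1 / 2 : ℝ) • fderiv ℝ (fderiv ℝ G) z (y - z) (y - z) with hq
  have h1 : ‖q‖ ≤ ‖fderiv ℝ (fderiv ℝ G) z‖ * ‖y - z‖ ^ 2 := by
    rw [hq, norm_smul]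
    have := (fderiv ℝ (fderiv ℝ G) z).le_opNorm₂ (y - z) (y - z)
    have h0 : (0:ℝ) ≤ ‖fderiv ℝ (fderiv ℝ G) z (y - z) (y - z)‖ := norm_nonneg _
    rw [Real.norm_of_nonneg (by norm_num : (0:ℝ) ≤ 1 / 2)]
    nlinarith
  rw [Real.norm_of_nonneg (by positivity : (0:ℝ) ≤ ‖y - z‖ ^ 2)] at hy
  calc _ = ‖(G y - G z - fderiv ℝ G z (y - z) - q) + q‖ := by rw [sub_add_cancel]
    _ ≤ _ := norm_add_le _ _
    _ ≤ _ := by linarith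

end Calculus

/-! ### Tangent cones, and normal cones of convex sets. -/

section TangentNormal

variable {W : Type*} [NormedAddCommGroup W] [NormedSpace ℝ W]

theorem mem_bouligandTangentCone_iff {Ω : Set W} {z w : W} :
    w ∈ bouligandTangentCone Ω z ↔ z ∈ Ω ∧ ∀ ε > 0, ∃ t : ℝ, 0 < t ∧ t < ε ∧
      ∃ w', ‖w' - w‖ < ε ∧ z + t • w' ∈ Ω := by
  constructor
  · rintro ⟨hz, t, wk, ht, ht0, hw, hmem⟩
    refine ⟨hz, fun ε hε => ?_⟩
    obtain ⟨k, hk1, hk2⟩ := ((ht0.eventually (gt_mem_nhds hε)).and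
      (Metric.tendsto_nhds.1 hw ε hε)).exists
    exact ⟨t k, ht k, hk1, wk k, by rwa [← dist_eq_norm], hmem k⟩
  · rintro ⟨hz, h⟩
    choose! t ht htε w' hw' hmem using h
    have hpos : ∀ k : ℕ, (0 : ℝ) < 1 / (k + 1) := fun k => Nat.one_div_pos_of_nat
    have h0 := tendsto_one_div_add_atTop_nhds_zero_nat (𝕜 := ℝ)
    refine ⟨hz, fun k => t (1 / (k + 1)), fun k => w' (1 / (k + 1)), fun k => ht _ (hpos k),
      squeeze_zero (fun k => (ht _ (hpos k)).le) (fun k => (htε _ (hpos k)).le) h0, ?_,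
      fun k => hmem _ (hpos k)⟩
    rw [tendsto_iff_norm_sub_tendsto_zero]
    exact squeeze_zero (fun k => norm_nonneg _) (fun k => (hw' _ (hpos k)).le) h0

theorem isClosed_bouligandTangentCone (Ω : Set W) (z : W) :
    IsClosed (bouligandTangentCone Ω z) := by
  refine isClosed_of_closure_subset fun w hw => ?_
  rw [Metric.mem_closure_iff] at hw
  rw [mem_bouligandTangentCone_iff]
  refine ⟨(hw 1 one_pos).choose_spec.1.1, fun ε hε => ?_⟩
  obtain ⟨w₁, hw₁, hd⟩ := hw (ε / 2) (half_pos hε)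
  obtain ⟨t, ht, htε, w', hw', hmem⟩ :=
    (mem_bouligandTangentCone_iff.1 hw₁).2 (ε / 2) (half_pos hε)
  refine ⟨t, ht, htε.trans (half_lt_self hε), w', ?_, hmem⟩
  calc ‖w' - w‖ = ‖(w' - w₁) + (w₁ - w)‖ := by abel_nf
    _ ≤ ‖w' - w₁‖ + ‖w₁ - w‖ := norm_add_le _ _
    _ < ε := by rw [dist_comm, dist_eq_norm] at hd; linarith

theorem regularNormalCone_subset_limitingNormalCone (Ω : Set W) (z : W) :
    regularNormalCone Ω z ⊆ limitingNormalCone Ω z := fun zs hzs =>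
  ⟨hzs.1, fun _ => z, fun _ => zs, fun _ => hzs.1, tendsto_const_nhds, fun _ => hzs,
    tendsto_const_nhds⟩

theorem limitingNormalCone_subset_convexifiedNormalCone (Ω : Set W) (z : W) :
    limitingNormalCone Ω z ⊆ convexifiedNormalCone Ω z :=
  (subset_convexHull ℝ _).trans subset_closure

theorem regularNormalCone_subset_normalCone (N : NormalConeKind) (Ω : Set W) (z : W) :
    regularNormalCone Ω z ⊆ normalCone N Ω z := by
  cases N
  · exact Subset.rfl
  · exact regularNormalCone_subset_limitingNormalCone Ω z
  · exact (regularNormalCone_subset_limitingNormalCone Ω z).trans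
      (limitingNormalCone_subset_convexifiedNormalCone Ω z)

/-- A closed convex set that contains the limiting normal cone and consists of regular normals
contains all three normal cones. -/
theorem normalCone_subset_of_limitingNormalCone_subset (N : NormalConeKind) {Ω : Set W} {z : W}
    {S : Set (StrongDual ℝ W)} (hS : limitingNormalCone Ω z ⊆ S) (hc : Convex ℝ S)
    (hcl : IsClosed S) : normalCone N Ω z ⊆ S := by
  cases N
  · exact (regularNormalCone_subset_limitingNormalCone Ω z).trans hS
  · exact hS
  · exact closure_minimal (convexHull_min hS hc) hcl

/-- The convexified cone carries no membership clause, but off Ω the limiting cone is empty, and so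
is its closed convex hull. -/
theorem mem_of_mem_normalCone {N : NormalConeKind} {Ω : Set W} {z : W} {zs : StrongDual ℝ W}
    (h : zs ∈ normalCone N Ω z) : z ∈ Ω := by
  by_contra hz
  have h0 : limitingNormalCone Ω z ⊆ ∅ := fun ys hys => hz hys.1
  exact normalCone_subset_of_limitingNormalCone_subset N h0 convex_empty isClosed_empty h

theorem mem_normalCone_of_forall_le (N : NormalConeKind) {S : Set W} {v : W}
    {zs : StrongDual ℝ W} (hv : v ∈ S) (h : ∀ y ∈ S, zs (y - v) ≤ 0) :
    zs ∈ normalCone N S v := by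
  refine regularNormalCone_subset_normalCone N S v ⟨hv, fun ε hε => ?_⟩
  filter_upwards [self_mem_nhdsWithin] with y hy
  exact (h y hy).trans (by positivity)

/-- On the segment from `v` to `y` both sides of the regular-normal inequality are proportional to
the step length, so the infinitesimal bound is already a global one. -/
theorem Convex.le_zero_of_mem_regularNormalCone {S : Set W} (hS : Convex ℝ S) {v : W}
    {zs : StrongDual ℝ W} (h : zs ∈ regularNormalCone S v) {y : W} (hy : y ∈ S) :
    zs (y - v) ≤ 0 := by
  refine le_of_forall_pos_le_add fun ε hε => ?_
  rw [zero_add]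
  set c := ‖y - v‖ with hc
  have hc0 : 0 ≤ c := norm_nonneg _
  -- The `+ 1` covers the case `y = v`, where `c = 0`.
  have hev := h.2 (ε / (c + 1)) (by positivity)
  have hlim : Tendsto (fun s : ℝ => v + s • (y - v)) (𝓝[>] 0) (𝓝[S] v) := by
    refine tendsto_nhdsWithin_iff.2 ⟨?_, ?_⟩
    · have : Tendsto (fun s : ℝ => v + s • (y - v)) (𝓝 0) (𝓝 (v + (0:ℝ) • (y - v))) :=
        Continuous.tendsto (by fun_prop) 0
      simpa using this.mono_left nhdsWithin_le_nhds
    · filter_upwards [Ioc_mem_nhdsGT (zero_lt_one' ℝ)] with s hs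
      exact hS.add_smul_sub_mem h.1 hy ⟨hs.1.le, hs.2⟩
  obtain ⟨s, hs1, hs0⟩ := ((hlim.eventually hev).and self_mem_nhdsWithin).exists
  have hs0 : 0 < s := hs0
  rw [add_sub_cancel_left, map_smul, smul_eq_mul, norm_smul, Real.norm_of_nonneg hs0.le] at hs1
  have h2 : zs (y - v) ≤ ε / (c + 1) * c := by
    refine le_of_mul_le_mul_left ?_ hs0
    linarith
  refine h2.trans ?_
  rw [div_mul_eq_mul_div, div_le_iff₀ (by positivity)]
  nlinarith

/-- The claimed inequality cuts out a closed half-space of functionals, so limiting normals suffice,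
and for these it is a limit of the regular case. With `mem_normalCone_of_forall_le` this makes the
kind `N` immaterial for the tangent and critical cones of the theorem. -/
theorem Convex.le_zero_of_mem_normalCone {N : NormalConeKind} {S : Set W} (hS : Convex ℝ S) {v : W}
    {zs : StrongDual ℝ W} (h : zs ∈ normalCone N S v) {y : W} (hy : y ∈ S) :
    zs (y - v) ≤ 0 := by
  have hconv : Convex ℝ {zs : StrongDual ℝ W | zs (y - v) ≤ 0} :=
    convex_halfSpace_le ⟨fun _ _ => rfl, fun _ _ => rfl⟩ 0
  have hcl : IsClosed {zs : StrongDual ℝ W | zs (y - v) ≤ 0} :=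
    isClosed_le (by fun_prop) continuous_const
  refine normalCone_subset_of_limitingNormalCone_subset N ?_ hconv hcl h
  rintro xs ⟨-, x, xsk, -, hx, hreg, hlim⟩
  have h1 : Tendsto (fun k => xsk k (y - x k)) atTop (𝓝 (xs (y - v))) :=
    tendsto_clm_apply hlim (tendsto_const_nhds.sub hx)
  exact le_of_tendsto' h1 fun k => hS.le_zero_of_mem_regularNormalCone (hreg k) hy

end TangentNormal

/-! ### Finitely generated cones: closedness and Farkas' lemma. -/

section FiniteCone

variable {ι W : Type*} [NormedAddCommGroup W] [NormedSpace ℝ W]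

/-- The convex cone generated by the finitely many vectors `a i`, `i ∈ I`. -/
def finiteCone (I : Finset ι) (a : ι → W) : Set W :=
  {w | ∃ c : ι → ℝ, (∀ i, 0 ≤ c i) ∧ ∑ i ∈ I, c i • a i = w}

theorem finiteCone_mono {I J : Finset ι} (h : I ⊆ J) (a : ι → W) :
    finiteCone I a ⊆ finiteCone J a := by
  classical
  rintro w ⟨c, hc, rfl⟩
  refine ⟨fun i => if i ∈ I then c i else 0, fun i => by
    dsimp only; split_ifs <;> simp [hc i], ?_⟩
  simp only [ite_smul, zero_smul, Finset.sum_ite_mem, Finset.inter_eq_right.2 h]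

theorem smul_mem_finiteCone {I : Finset ι} {a : ι → W} {w : W} (hw : w ∈ finiteCone I a) {r : ℝ}
    (hr : 0 ≤ r) : r • w ∈ finiteCone I a := by
  obtain ⟨c, hc, rfl⟩ := hw
  exact ⟨fun i => r * c i, fun i => mul_nonneg hr (hc i), by
    simp only [mul_smul, Finset.smul_sum]⟩

theorem add_mem_finiteCone {I : Finset ι} {a : ι → W} {w w' : W} (hw : w ∈ finiteCone I a)
    (hw' : w' ∈ finiteCone I a) : w + w' ∈ finiteCone I a := by
  obtain ⟨c, hc, rfl⟩ := hw
  obtain ⟨c', hc', rfl⟩ := hw'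
  exact ⟨fun i => c i + c' i, fun i => add_nonneg (hc i) (hc' i), by
    simp only [add_smul, Finset.sum_add_distrib]⟩

theorem convex_finiteCone (I : Finset ι) (a : ι → W) : Convex ℝ (finiteCone I a) :=
  fun _ hx _ hy _ _ hr hs _ =>
    add_mem_finiteCone (smul_mem_finiteCone hx hr) (smul_mem_finiteCone hy hs)

/-- Carathéodory's reduction for cones. -/
theorem exists_mem_finiteCone_erase [DecidableEq ι] {I : Finset ι} {a : ι → W} {g : ι → ℝ}
    (hg : ∑ i ∈ I, g i • a i = 0) {j : ι} (hj : j ∈ I) (hgj : 0 < g j) {w : W}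
    (hw : w ∈ finiteCone I a) : ∃ i ∈ I, w ∈ finiteCone (I.erase i) a := by
  obtain ⟨c, hc, rfl⟩ := hw
  -- The ratio test: subtracting the smallest ratio c/g times the relation `g` cancels the
  -- coefficient at `m` and leaves the others nonnegative.
  obtain ⟨m, hm, hmin⟩ := (I.filter fun i => 0 < g i).exists_min_image (fun i => c i / g i)
    ⟨j, by simp [hj, hgj]⟩
  rw [Finset.mem_filter] at hm
  have hnn : ∀ i ∈ I, 0 ≤ c i - c m / g m * g i := by
    intro i hi
    rcases lt_or_ge 0 (g i) with hgi | hgi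
    · have := hmin i (by simp [hi, hgi])
      rw [le_div_iff₀ hgi] at this
      linarith
    · have h1 : 0 ≤ c m / g m := div_nonneg (hc m) hm.2.le
      nlinarith [hc i]
  -- The `max` changes nothing on `I`; it only secures nonnegativity at indices outside `I`, which
  -- `finiteCone` also asks for.
  refine ⟨m, hm.1, fun i => max (c i - c m / g m * g i) 0, fun i => le_max_right _ _, ?_⟩
  have h1 : ∀ i ∈ I.erase m, max (c i - c m / g m * g i) 0 • a i =
      (c i - c m / g m * g i) • a i := fun i hi => by
    rw [max_eq_left (hnn i (Finset.mem_of_mem_erase hi))]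
  have h2 : (c m - c m / g m * g m) • a m = 0 := by
    rw [div_mul_cancel₀ _ hm.2.ne', sub_self, zero_smul]
  rw [Finset.sum_congr rfl h1,
    Finset.sum_erase I (f := fun i => (c i - c m / g m * g i) • a i) h2]
  simp only [sub_smul, Finset.sum_sub_distrib, mul_smul, ← Finset.smul_sum, hg, smul_zero,
    sub_zero]

/-- For independent generators the cone is the image of an orthant under a closed embedding.
Otherwise Carathéodory's reduction writes it as a finite union of cones with fewer generators. -/
theorem isClosed_finiteCone (I : Finset ι) (a : ι → W) : IsClosed (finiteCone I a) := by
  classical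
  induction I using Finset.strongInduction with
  | H I ih =>
    by_cases hli : LinearIndependent ℝ (fun i : I => a i)
    · set f : (I → ℝ) →ₗ[ℝ] W := Fintype.linearCombination ℝ (fun i : I => a i) with hf
      have hinj : Function.Injective f := by
        exact linearIndependent_iff_injective_fintypeLinearCombination.1 hli
      have hemb := LinearMap.isClosedEmbedding_of_injective (𝕜 := ℝ)
        (LinearMap.ker_eq_bot.2 hinj)
      have hset : finiteCone I a = f '' {c | ∀ i, 0 ≤ c i} := by
        ext w
        constructor
        · rintro ⟨c, hc, rfl⟩
          refine ⟨fun i => c i, fun i => hc i, ?_⟩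
          rw [hf, Fintype.linearCombination_apply]
          exact Finset.sum_coe_sort I (fun i => c i • a i)
        · rintro ⟨c, hc, rfl⟩
          refine ⟨fun i => if h : i ∈ I then c ⟨i, h⟩ else 0, fun i => ?_, ?_⟩
          · dsimp only; split_ifs with h
            exacts [hc _, le_rfl]
          · rw [hf, Fintype.linearCombination_apply,
              ← Finset.sum_coe_sort I]
            refine Finset.sum_congr rfl fun i _ => ?_
            simp
      rw [hset]
      refine hemb.isClosedMap _ ?_
      simp only [ofPred_forall]
      exact isClosed_iInter fun i => isClosed_le continuous_const (continuous_apply i)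
    · have hset : finiteCone I a = ⋃ i ∈ I, finiteCone (I.erase i) a := by
        refine Subset.antisymm (fun w hw => ?_)
          (iUnion₂_subset fun i _ => finiteCone_mono (Finset.erase_subset i I) a)
        rw [Fintype.not_linearIndependent_iff] at hli
        obtain ⟨g, hg, j, hj⟩ := hli
        set g' : ι → ℝ := fun i => if h : i ∈ I then g ⟨i, h⟩ else 0 with hg'
        have hg0 : ∑ i ∈ I, g' i • a i = 0 := by
          rw [← hg, ← Finset.sum_coe_sort I]
          exact Finset.sum_congr rfl fun i _ => by simp [hg']
        have hgj : g' j ≠ 0 := by simpa [hg'] using hj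
        rw [mem_iUnion₂]
        simp only [exists_prop]
        -- The ratio test needs a positive coefficient; the relation may be negated to obtain one.
        rcases lt_or_gt_of_ne hgj with h | h
        · refine exists_mem_finiteCone_erase (g := -g') ?_ j.2 (by simpa using h) hw
          simp [hg0]
        · exact exists_mem_finiteCone_erase hg0 j.2 h hw
      rw [hset]
      exact isClosed_biUnion_finset fun i hi => ih _ (Finset.erase_ssubset hi)

/-- Reflexivity in finite dimension: a functional that separates sets of functionals comes from a
vector. -/
theorem exists_forall_eq_eval [FiniteDimensional ℝ W] (f : StrongDual ℝ (StrongDual ℝ W)) :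
    ∃ u : W, ∀ ν : StrongDual ℝ W, f ν = ν u := by
  obtain ⟨u, hu⟩ := (Module.evalEquiv ℝ W).surjective
    (f.toLinearMap ∘ₗ (LinearMap.toContinuousLinearMap (𝕜 := ℝ) (E := W) (F' := ℝ)).toLinearMap)
  refine ⟨u, fun ν => ?_⟩
  have := LinearMap.congr_fun hu ν.toLinearMap
  exact this.symm

/-- **Farkas' lemma** for the dual of a finitely generated cone of functionals. -/
theorem mem_finiteCone_of_forall_le [FiniteDimensional ℝ W] {I : Finset ι}
    {a : ι → StrongDual ℝ W} {μ : StrongDual ℝ W}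
    (h : ∀ e, (∀ i ∈ I, a i e ≤ 0) → μ e ≤ 0) : μ ∈ finiteCone I a := by
  classical
  by_contra hμ
  obtain ⟨f, u, hfu, hu⟩ := geometric_hahn_banach_closed_point (convex_finiteCone I a)
    (isClosed_finiteCone I a) hμ
  obtain ⟨e, he⟩ := exists_forall_eq_eval f
  have hu0 : 0 < u := by simpa using hfu 0 ⟨0, by simp, by simp⟩
  have hle : ∀ i ∈ I, a i e ≤ 0 := by
    intro i hi
    by_contra! hpos
    -- Scaled so that its value at `e` is exactly `u`, which contradicts the strict separation.
    have hmem : (u / a i e) • a i ∈ finiteCone I a :=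
      smul_mem_finiteCone ⟨Pi.single i 1, fun j => by
        by_cases h : j = i
        · subst h; simp
        · simp [h], by
          rw [Finset.sum_eq_single i (fun j _ hj => by simp [hj]) (fun h => (h hi).elim)]
          simp⟩ (by positivity)
    have := hfu _ hmem
    rw [he, smul_apply, smul_eq_mul, div_mul_cancel₀ _ hpos.ne'] at this
    exact lt_irrefl _ this
  have := h e hle
  rw [he] at hu
  linarith

end FiniteCone

/-! ### Closedness and convexity of the regular normal cone. -/

section RegularNormalCone

variable {W : Type*} [NormedAddCommGroup W] [NormedSpace ℝ W]

theorem convex_regularNormalCone (Ω : Set W) (z : W) : Convex ℝ (regularNormalCone Ω z) := by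
  rintro a ⟨hz, ha⟩ b ⟨-, hb⟩ r s hr hs hrs
  refine ⟨hz, fun ε hε => ?_⟩
  filter_upwards [ha ε hε, hb ε hε] with y hya hyb
  calc (r • a + s • b) (y - z) = r * a (y - z) + s * b (y - z) := by simp
    _ ≤ r * (ε * ‖y - z‖) + s * (ε * ‖y - z‖) := by gcongr
    _ = ε * ‖y - z‖ := by rw [← add_mul, hrs, one_mul]

theorem isClosed_regularNormalCone (Ω : Set W) (z : W) : IsClosed (regularNormalCone Ω z) := by
  refine isClosed_of_closure_subset fun a ha => ?_
  rw [Metric.mem_closure_iff] at ha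
  refine ⟨(ha 1 one_pos).choose_spec.1.1, fun ε hε => ?_⟩
  obtain ⟨b, hb, hab⟩ := ha (ε / 2) (half_pos hε)
  filter_upwards [hb.2 (ε / 2) (half_pos hε)] with y hy
  have h1 : (a - b) (y - z) ≤ ε / 2 * ‖y - z‖ := by
    refine (le_abs_self _).trans (((a - b).le_opNorm (y - z)).trans ?_)
    rw [dist_eq_norm] at hab
    gcongr
  have h2 : a (y - z) = (a - b) (y - z) + b (y - z) := by simp
  linarith

end RegularNormalCone

/-! ### Bounded multipliers for regular normals. -/

section Multiplier

variable {X E : Type*} [NormedAddCommGroup X] [NormedSpace ℝ X]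
  [NormedAddCommGroup E] [InnerProductSpace ℝ E]

theorem nonpos_of_forall_mul_le {a c : ℝ} (h : ∀ s : ℝ, 0 < s → s * a ≤ c) : a ≤ 0 := by
  by_contra! ha
  have h1 := h ((|c| + 1) / a) (by positivity)
  rw [div_mul_cancel₀ _ ha.ne'] at h1
  linarith [le_abs_self c]

/-- If `xs` is bounded from above by `L` times the distance of the image under `B` to the tangent
cone of `K` at `y`, then `xs` is the image of a normal of norm at most `L`. -/
theorem exists_multiplier_of_forall_le [FiniteDimensional ℝ X] [FiniteDimensional ℝ E]
    (K : ProperCone ℝ E) {y : E} (B : X →L[ℝ] E) {xs : StrongDual ℝ X} {L : ℝ} (hL : 0 ≤ L)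
    (h : ∀ u, ∀ e ∈ K, ∀ α : ℝ, xs u ≤ L * ‖B u - (e + α • y)‖) :
    ∃ μ ∈ polarCone (K : Set E), μ y = 0 ∧ ‖μ‖ ≤ L ∧ μ.comp B = xs := by
  set M : Set (StrongDual ℝ E) := {μ | (∀ e ∈ K, μ e ≤ 0) ∧ μ y = 0 ∧ ‖μ‖ ≤ L} with hM
  have : ProperSpace (StrongDual ℝ E) := FiniteDimensional.proper ℝ _
  have hMcomp : IsCompact M := by
    refine (isCompact_closedBall (0 : StrongDual ℝ E) L).of_isClosed_subset ?_ fun μ hμ => by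
      simpa using hμ.2.2
    have : M = (⋂ e ∈ K, {μ | μ e ≤ 0}) ∩ ({μ | μ y = 0} ∩ {μ | ‖μ‖ ≤ L}) := by
      ext μ; simp [hM]
    rw [this]
    refine (isClosed_biInter fun e _ => isClosed_le (by fun_prop) (by fun_prop)).inter
      ((isClosed_eq (by fun_prop) (by fun_prop)).inter (isClosed_le (by fun_prop) (by fun_prop)))
  have hMconv : Convex ℝ M := by
    rintro a ⟨ha1, ha2, ha3⟩ b ⟨hb1, hb2, hb3⟩ r s hr hs hrs
    refine ⟨fun e he => ?_, by simp [ha2, hb2], ?_⟩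
    · have h1 := ha1 e he
      have h2 := hb1 e he
      simp only [add_apply, smul_apply, smul_eq_mul]
      nlinarith
    · calc ‖r • a + s • b‖ ≤ r * ‖a‖ + s * ‖b‖ := by
            refine (norm_add_le _ _).trans (le_of_eq ?_)
            rw [norm_smul, norm_smul, Real.norm_of_nonneg hr, Real.norm_of_nonneg hs]
        _ ≤ r * L + s * L := by gcongr
        _ = L := by rw [← add_mul, hrs, one_mul]
  set T : StrongDual ℝ E →L[ℝ] StrongDual ℝ X :=
    (ContinuousLinearMap.compL ℝ X E ℝ).flip B with hT
  suffices hmem : xs ∈ T '' M by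
    obtain ⟨μ, ⟨h1, h2, h3⟩, rfl⟩ := hmem
    exact ⟨μ, h1, h2, h3, rfl⟩
  by_contra hxs
  obtain ⟨f, c, hf, hc⟩ := geometric_hahn_banach_closed_point
    (hMconv.linear_image T.toLinearMap) (hMcomp.image T.continuous).isClosed hxs
  obtain ⟨u, hu⟩ := exists_forall_eq_eval f
  rw [hu] at hc
  replace hf : ∀ μ ∈ M, μ (B u) < c := fun μ hμ => by
    have := hf (T μ) ⟨μ, hμ, rfl⟩
    rwa [hu] at this
  -- For y ∈ K the closure of D = K + ℝy is the tangent cone to K at y. The residual of projecting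
  -- Bu onto it is polar to K and orthogonal to y. Rescaled to norm L it belongs to `M` and attains
  -- at least L‖r‖ ≥ xs u, against the separation.
  set D : Set E := {d | ∃ e ∈ K, ∃ α : ℝ, e + α • y = d} with hD
  have hD0 : (0 : E) ∈ D := ⟨0, K.zero_mem, 0, by simp⟩
  have hDconv : Convex ℝ D := by
    rintro _ ⟨e, he, α, rfl⟩ _ ⟨e', he', α', rfl⟩ r s hr hs -
    refine ⟨r • e + s • e', K.add_mem (K.smul_mem he hr) (K.smul_mem he' hs), r * α + s * α', ?_⟩
    module
  obtain ⟨d, hd, hdmin⟩ := exists_norm_eq_iInf_of_complete_convex ⟨0, subset_closure hD0⟩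
    (isClosed_closure (s := D)).isComplete hDconv.closure (B u)
  rw [norm_eq_iInf_iff_real_inner_le_zero hDconv.closure hd] at hdmin
  have hle : xs u ≤ L * ‖B u - d‖ := by
    have hcl : IsClosed {d | xs u ≤ L * ‖B u - d‖} := isClosed_le (by fun_prop) (by fun_prop)
    refine closure_minimal ?_ hcl hd
    rintro _ ⟨e, he, α, rfl⟩
    exact h u e he α
  set r := B u - d with hr
  have hrD : ∀ w ∈ D, inner ℝ r w ≤ inner ℝ r d := fun w hw => by
    have := hdmin w (subset_closure hw)
    rw [inner_sub_right] at this
    linarith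
  have hrd : 0 ≤ inner ℝ r d := by simpa using hrD 0 hD0
  have hrK : ∀ e ∈ K, inner ℝ r e ≤ 0 := fun e he =>
    nonpos_of_forall_mul_le fun s hs => by
      have := hrD (s • e) ⟨s • e, K.smul_mem he hs.le, 0, by simp⟩
      rwa [inner_smul_right] at this
  have hry : inner ℝ r y = 0 := by
    refine le_antisymm (nonpos_of_forall_mul_le (c := inner ℝ r d) fun s hs => ?_) ?_
    · have := hrD (s • y) ⟨0, K.zero_mem, s, by simp⟩
      rwa [inner_smul_right] at this
    · rw [← neg_nonpos]
      refine nonpos_of_forall_mul_le (c := inner ℝ r d) fun s hs => ?_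
      have := hrD (-s • y) ⟨0, K.zero_mem, -s, by simp⟩
      rw [inner_smul_right] at this
      linarith
  have hrB : ‖r‖ ^ 2 ≤ inner ℝ r (B u) := by
    have : B u = r + d := by simp [hr]
    rw [this, inner_add_right, real_inner_self_eq_norm_sq]
    linarith
  -- For r = 0 the convention 0⁻¹ = 0 makes this the zero functional, still in `M`.
  have hinvM : (L * ‖r‖⁻¹) • innerSL ℝ r ∈ M := by
    have hnn : 0 ≤ L * ‖r‖⁻¹ := by positivity
    refine ⟨fun e he => ?_, ?_, ?_⟩
    · simpa using mul_nonpos_of_nonneg_of_nonpos hnn (hrK e he)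
    · simp [hry]
    · rw [norm_smul, Real.norm_of_nonneg hnn, innerSL_apply_norm, mul_assoc]
      calc L * (‖r‖⁻¹ * ‖r‖) ≤ L * 1 := by
            gcongr
            exact inv_mul_le_one
        _ = L := mul_one L
  have h1 := hf _ hinvM
  simp only [smul_apply, innerSL_apply_apply, smul_eq_mul] at h1
  have h2 : L * ‖r‖ ≤ L * ‖r‖⁻¹ * inner ℝ r (B u) := by
    rcases eq_or_ne ‖r‖ 0 with h0 | h0
    · simp [h0]
    · calc L * ‖r‖ = L * ‖r‖⁻¹ * ‖r‖ ^ 2 := by field_simp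
        _ ≤ _ := by gcongr
  linarith

/-- Regular normals to the solution set of a metrically subregular conic system admit multipliers
that are bounded by the subregularity modulus. -/
theorem exists_multiplier_of_mem_regularNormalCone [FiniteDimensional ℝ X] [FiniteDimensional ℝ E]
    {K : ProperCone ℝ E} {S : Set X} {f : X → E} {x : X} {B : X →L[ℝ] E} {κ : ℝ} (hκ : 0 ≤ κ)
    (hf : HasFDerivAt f B x) (hfx : f x ∈ K)
    (hS : ∀ᶠ x' in 𝓝 x, ∀ k ∈ K, ∀ ε > 0, ∃ x'' ∈ S, ‖x'' - x'‖ ≤ κ * ‖f x' - k‖ + ε)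
    {xs : StrongDual ℝ X} (hxs : xs ∈ regularNormalCone S x) :
    ∃ μ ∈ polarCone (K : Set E), μ (f x) = 0 ∧ ‖μ‖ ≤ κ * ‖xs‖ ∧ μ.comp B = xs := by
  refine exists_multiplier_of_forall_le K B (by positivity) fun u e he α => ?_
  set y := f x with hy
  have hid : Tendsto (fun t : ℝ => t) (𝓝[>] 0) (𝓝 0) := nhdsWithin_le_nhds
  have hpos : ∀ᶠ t : ℝ in 𝓝[>] 0, 0 < t := self_mem_nhdsWithin
  have hxt : Tendsto (fun t : ℝ => x + t • u) (𝓝[>] 0) (𝓝 x) := by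
    simpa using tendsto_const_nhds.add (hid.smul_const u)
  -- Here t · r(t) bounds the distance from x + tu to a suitable point of `S`: subregularity is
  -- applied with the cone element (1 + tα)y + te, which is in K for small t even if α < 0. The
  -- final `+ t` comes from the slack t².
  set r : ℝ → ℝ := fun t => κ * ‖t⁻¹ • (f (x + t • u) - y) - (e + α • y)‖ + t with hr
  have hrlim : Tendsto r (𝓝[>] 0) (𝓝 (κ * ‖B u - (e + α • y)‖)) := by
    have hq : Tendsto (fun t : ℝ => t⁻¹ • (f (x + t • u) - y)) (𝓝[>] 0) (𝓝 (B u)) := by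
      refine (hasFDerivWithinAt_univ.2 hf).lim (by simpa using hid.smul_const u)
        (.of_forall fun _ => mem_univ _) ?_
      refine tendsto_const_nhds.congr' ?_
      filter_upwards [hpos] with t ht
      rw [smul_smul, inv_mul_cancel₀ ht.ne', one_smul]
    simpa using ((hq.sub_const (e + α • y)).norm.const_mul κ).add hid
  have hex : ∀ᶠ t : ℝ in 𝓝[>] 0, ∃ x'' ∈ S, ‖x'' - (x + t • u)‖ ≤ t * r t := by
    have hα : ∀ᶠ t : ℝ in 𝓝[>] 0, 0 < 1 + t * α := by
      have : Tendsto (fun t : ℝ => 1 + t * α) (𝓝[>] 0) (𝓝 1) := by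
        simpa using (hid.mul_const α).const_add 1
      exact this.eventually (lt_mem_nhds one_pos)
    filter_upwards [hxt.eventually hS, hpos, hα] with t ht htpos htα
    obtain ⟨x'', hx'', hle⟩ := ht ((1 + t * α) • y + t • e)
      (K.add_mem (K.smul_mem hfx htα.le) (K.smul_mem he htpos.le)) (t * t) (by positivity)
    refine ⟨x'', hx'', hle.trans (le_of_eq ?_)⟩
    have h1 : f (x + t • u) - ((1 + t * α) • y + t • e) =
        t • (t⁻¹ • (f (x + t • u) - y) - (e + α • y)) := by
      rw [smul_sub, smul_smul, mul_inv_cancel₀ htpos.ne']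
      module
    rw [h1, norm_smul, Real.norm_of_nonneg htpos.le, hr]
    ring
  choose! x'' hx''S hx'' using fun (t : ℝ) (h : ∃ x'' ∈ S, ‖x'' - (x + t • u)‖ ≤ t * r t) => h
  have hx''lim : Tendsto x'' (𝓝[>] 0) (𝓝[S] x) := by
    refine tendsto_nhdsWithin_iff.2 ⟨?_, hex.mono hx''S⟩
    have h0 : Tendsto (fun t => x'' t - (x + t • u)) (𝓝[>] 0) (𝓝 0) := by
      refine squeeze_zero_norm' (hex.mono hx'') ?_
      simpa using hid.mul hrlim
    simpa using h0.add hxt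
  -- The regular-normal inequality at x''(t), divided by t, in the limit t ↓ 0. Afterwards η ↓ 0.
  have hη : ∀ η : ℝ, 0 < η →
      xs u ≤ η * (‖u‖ + κ * ‖B u - (e + α • y)‖) + ‖xs‖ * (κ * ‖B u - (e + α • y)‖) := by
    intro η hη
    refine ge_of_tendsto (((hrlim.const_add ‖u‖).const_mul η).add (hrlim.const_mul ‖xs‖)) ?_
    filter_upwards [hx''lim.eventually (hxs.2 η hη), hex, hpos] with t h1 h2 htpos
    have h3 := hx'' t h2
    have h4 : ‖x'' t - x‖ ≤ t * (‖u‖ + r t) := by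
      calc ‖x'' t - x‖ = ‖(x'' t - (x + t • u)) + t • u‖ := by congr 1; abel
        _ ≤ t * r t + t * ‖u‖ := by
          refine (norm_add_le _ _).trans ?_
          rw [norm_smul, Real.norm_of_nonneg htpos.le]
          gcongr
        _ = _ := by ring
    have h5 : -xs (x'' t - (x + t • u)) ≤ ‖xs‖ * (t * r t) := by
      refine (neg_le_abs _).trans ((xs.le_opNorm _).trans ?_)
      gcongr
    have h6 : t * xs u = xs (x'' t - x) - xs (x'' t - (x + t • u)) := by
      simp only [map_sub, map_add, map_smul, smul_eq_mul]; ring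
    have h7 : η * ‖x'' t - x‖ ≤ η * (t * (‖u‖ + r t)) := by gcongr
    refine le_of_mul_le_mul_left ?_ htpos
    linarith
  have hlim : Tendsto (fun η : ℝ => η * (‖u‖ + κ * ‖B u - (e + α • y)‖) +
      ‖xs‖ * (κ * ‖B u - (e + α • y)‖)) (𝓝[>] 0)
      (𝓝 (0 * (‖u‖ + κ * ‖B u - (e + α • y)‖) + ‖xs‖ * (κ * ‖B u - (e + α • y)‖))) :=
    (hid.mul_const _).add_const _
  have := ge_of_tendsto hlim (by filter_upwards [hpos] with η h using hη η h)
  linarith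

end Multiplier

/-! ### Multipliers for stable parametric systems. -/

section StableSystem

variable {P X E : Type*} [NormedAddCommGroup P] [NormedSpace ℝ P]
  [NormedAddCommGroup X] [NormedSpace ℝ X]
  [NormedAddCommGroup E] [InnerProductSpace ℝ E]

/-- Near `z`, the graph of `Γ` is described by the conic system `G (p, x) ∈ K` with a twice
continuously differentiable `G` that vanishes at `z`, and this system is Robinson stable. -/
structure IsStableConicSystem (Γ : P → Set X) (G : P × X → E) (K : ProperCone ℝ E) (z : P × X) :
    Prop where
  contDiffAt : ContDiffAt ℝ 2 G z
  map_eq_zero : G z = 0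
  mem_iff : ∀ᶠ y in 𝓝 z, y.2 ∈ Γ y.1 ↔ G y ∈ K
  exists_near : ∃ κ : ℝ, 0 ≤ κ ∧ ∀ᶠ y in 𝓝 z, ∀ k ∈ K, ∀ ε > 0,
    ∃ x ∈ Γ y.1, ‖x - y.2‖ ≤ κ * ‖G y - k‖ + ε

variable {Γ : P → Set X} {G : P × X → E} {K : ProperCone ℝ E} {z : P × X}

theorem HasFDerivAt.comp_prodMk_left {A : P × X →L[ℝ] E} {y : P × X} (h : HasFDerivAt G A y) :
    HasFDerivAt (fun x => G (y.1, x)) (A.comp (ContinuousLinearMap.inr ℝ P X)) y.2 :=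
  HasFDerivAt.comp (f := fun x => (y.1, x)) y.2 h (hasFDerivAt_prodMk_right y.1 y.2)

/-- Near the reference point, normals to `Γ p` of any kind admit bounded multipliers. -/
theorem IsStableConicSystem.exists_multiplier [FiniteDimensional ℝ X] [FiniteDimensional ℝ E]
    (hs : IsStableConicSystem Γ G K z) (N : NormalConeKind) :
    ∃ κ : ℝ, 0 ≤ κ ∧ ∀ᶠ y in 𝓝 z, ∀ xs ∈ normalCone N (Γ y.1) y.2,
      ∃ μ ∈ polarCone (K : Set E), μ (G y) = 0 ∧ ‖μ‖ ≤ κ * ‖xs‖ ∧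
        μ.comp ((fderiv ℝ G y).comp (ContinuousLinearMap.inr ℝ P X)) = xs := by
  obtain ⟨κ, hκ, hnear⟩ := hs.exists_near
  refine ⟨κ, hκ, ?_⟩
  have hC2 := hs.contDiffAt.eventually (by simp)
  have hslice : ∀ {p : P × X → Prop} {y : P × X}, (∀ᶠ y' in 𝓝 y, p y') →
      ∀ᶠ x in 𝓝 y.2, p (y.1, x) := fun {p y} h =>
    (Continuous.tendsto (by fun_prop : Continuous fun x : X => (y.1, x)) y.2).eventually h
  have hreg : ∀ᶠ y in 𝓝 z, ∀ xs ∈ regularNormalCone (Γ y.1) y.2,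
      ∃ μ ∈ polarCone (K : Set E), μ (G y) = 0 ∧ ‖μ‖ ≤ κ * ‖xs‖ ∧
        μ.comp ((fderiv ℝ G y).comp (ContinuousLinearMap.inr ℝ P X)) = xs := by
    filter_upwards [hC2, hs.mem_iff, eventually_eventually_nhds.2 hnear] with y h1 h2 h3 xs hxs
    exact exists_multiplier_of_mem_regularNormalCone hκ
      (h1.differentiableAt (by simp)).hasFDerivAt.comp_prodMk_left
      (h2.1 hxs.1) (hslice h3) hxs
  filter_upwards [hC2, hs.mem_iff, eventually_eventually_nhds.2 hs.mem_iff, hreg,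
    eventually_eventually_nhds.2 (hreg.and (hC2.and hs.mem_iff))] with y h1 h2 h3 h4 h5 xs hxs
  -- Since the regular normal cone is closed and convex, it suffices that limiting normals are
  -- regular. Bounded multipliers of approximating regular normals subconverge to a multiplier `μ₀`,
  -- and any multiplier yields a regular normal.
  refine h4 xs (normalCone_subset_of_limitingNormalCone_subset N ?_ (convex_regularNormalCone _ _)
    (isClosed_regularNormalCone _ _) hxs)
  rintro xs ⟨hy, x, xsk, hxΓ, hx, hxreg, hlim⟩
  have hprod : Tendsto (fun k => ((y.1, x k) : P × X)) atTop (𝓝 y) :=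
    tendsto_const_nhds.prodMk_nhds hx
  obtain ⟨k₀, hk₀⟩ := eventually_atTop.1 (hprod.eventually h5)
  have hex : ∀ k, ∃ μ ∈ polarCone (K : Set E), μ (G (y.1, x (k + k₀))) = 0 ∧
      ‖μ‖ ≤ κ * ‖xsk (k + k₀)‖ ∧ μ.comp ((fderiv ℝ G (y.1, x (k + k₀))).comp
        (ContinuousLinearMap.inr ℝ P X)) = xsk (k + k₀) := fun k =>
    (hk₀ (k + k₀) (Nat.le_add_left _ _)).1 _ (hxreg _)
  choose μ hμK hμ0 hμle hμeq using hex
  have : ProperSpace (StrongDual ℝ E) := FiniteDimensional.proper ℝ _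
  obtain ⟨R, hR⟩ := (hlim.norm.comp (tendsto_add_atTop_nat k₀)).bddAbove_range
  obtain ⟨μ₀, -, φ, hφ, hμlim⟩ := tendsto_subseq_of_bounded
    (Metric.isBounded_closedBall (x := (0 : StrongDual ℝ E)) (r := κ * R)) (x := μ) (fun k => by
      rw [mem_closedBall_zero_iff]
      refine (hμle k).trans ?_
      gcongr
      exact hR ⟨k, rfl⟩)
  have hshift : Tendsto (fun k => φ k + k₀) atTop atTop :=
    (tendsto_add_atTop_nat k₀).comp hφ.tendsto_atTop
  have hprod' := hprod.comp hshift
  have hA : Tendsto (fun k => (fderiv ℝ G (y.1, x (φ k + k₀))).comp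
      (ContinuousLinearMap.inr ℝ P X)) atTop
      (𝓝 ((fderiv ℝ G y).comp (ContinuousLinearMap.inr ℝ P X))) := by
    have hc : ContinuousAt (fderiv ℝ G) y :=
      (h1.fderiv_right (m := 1) (by norm_num)).continuousAt
    have := (hc.tendsto.comp hprod')
    exact ((((ContinuousLinearMap.compL ℝ X (P × X) E).flip
      (ContinuousLinearMap.inr ℝ P X)).continuous.tendsto _).comp this)
  have hxs_eq : μ₀.comp ((fderiv ℝ G y).comp (ContinuousLinearMap.inr ℝ P X)) = xs := by
    ext u
    have ha := tendsto_clm_apply hμlim (tendsto_clm_apply hA (tendsto_const_nhds (x := u)))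
    have hb := tendsto_clm_apply (hlim.comp hshift) (tendsto_const_nhds (x := u))
    refine tendsto_nhds_unique (ha.congr fun k => ?_) hb
    exact congrArg (fun ν : StrongDual ℝ X => ν u) (hμeq (φ k))
  have hμ₀K : ∀ e ∈ K, μ₀ e ≤ 0 := fun e he =>
    le_of_tendsto' (tendsto_clm_apply hμlim (tendsto_const_nhds (x := e)))
      fun k => hμK (φ k) e he
  have hμ₀0 : μ₀ (G y) = 0 := by
    have hG := h1.continuousAt.tendsto.comp hprod'
    exact tendsto_nhds_unique (tendsto_clm_apply hμlim hG)
      (tendsto_const_nhds.congr fun k => (hμ0 (φ k)).symm)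
  subst hxs_eq
  -- Feasible points have μ₀(G) ≤ 0 while μ₀(G y) = 0, so μ₀(B(x' − y.2)) is at most the first-order
  -- remainder.
  refine ⟨hy, fun ε hε => ?_⟩
  have hder := (h1.differentiableAt (by simp)).hasFDerivAt.comp_prodMk_left
  have hlo := Asymptotics.isLittleO_iff.1 hder.isLittleO
    (show 0 < ε / (‖μ₀‖ + 1) by positivity)
  filter_upwards [nhdsWithin_le_nhds hlo, nhdsWithin_le_nhds (hslice h3), self_mem_nhdsWithin]
    with x' ha hb hc
  have hGx' : μ₀ (G (y.1, x')) ≤ 0 := hμ₀K _ (hb.1 hc)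
  set B := (fderiv ℝ G y).comp (ContinuousLinearMap.inr ℝ P X) with hB
  have hd : -μ₀ (G (y.1, x') - G (y.1, y.2) - B (x' - y.2)) ≤
      ‖μ₀‖ * (ε / (‖μ₀‖ + 1) * ‖x' - y.2‖) := by
    refine (neg_le_abs _).trans ((μ₀.le_opNorm _).trans ?_)
    gcongr
  have he : ‖μ₀‖ * (ε / (‖μ₀‖ + 1) * ‖x' - y.2‖) ≤ ε * ‖x' - y.2‖ := by
    rw [← mul_assoc]
    gcongr
    rw [mul_div_assoc', div_le_iff₀ (by positivity)]
    nlinarith [norm_nonneg μ₀]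
  rw [map_sub, map_sub, hμ₀0] at hd
  rw [ContinuousLinearMap.comp_apply]
  linarith

end StableSystem

section FiniteConeImage

variable {ι W W' : Type*} [NormedAddCommGroup W] [NormedSpace ℝ W]
  [NormedAddCommGroup W'] [NormedSpace ℝ W']

/-- The set is itself a finitely generated cone, with −x adjoined as generator `none`. It serves to
take limits of t⁻¹(Tμ_k − Tμ₀), whose two parts need not converge separately. -/
theorem isClosed_image_finiteCone_sub_ray (I : Finset ι) (a : ι → W) (T : W →L[ℝ] W') (x : W') :
    IsClosed {y | ∃ w ∈ finiteCone I a, ∃ s : ℝ, 0 ≤ s ∧ y = T w - s • x} := by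
  have : {y | ∃ w ∈ finiteCone I a, ∃ s : ℝ, 0 ≤ s ∧ y = T w - s • x} =
      finiteCone (Finset.insertNone I) (fun o => o.elim (-x) (fun i => T (a i))) := by
    ext y
    constructor
    · rintro ⟨_, ⟨c, hc, rfl⟩, s, hs, rfl⟩
      refine ⟨fun o => o.elim s c, fun o => ?_, ?_⟩
      · cases o
        exacts [hs, hc _]
      · simp [Finset.sum_insertNone, map_sum, sub_eq_neg_add]
    · rintro ⟨c, hc, rfl⟩
      refine ⟨_, ⟨fun i => c (some i), fun i => hc _, rfl⟩, c none, hc _, ?_⟩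
      simp [Finset.sum_insertNone, map_sum, sub_eq_neg_add]
  rw [this]
  exact isClosed_finiteCone _ _

end FiniteConeImage

/-! ### The tangent cone to the graph of Γ, and the upper estimate. -/

section StableSystem

variable {P X E : Type*} [NormedAddCommGroup P] [NormedSpace ℝ P]
  [NormedAddCommGroup X] [NormedSpace ℝ X]
  [NormedAddCommGroup E] [InnerProductSpace ℝ E]
  {Γ : P → Set X} {G : P × X → E} {K : ProperCone ℝ E} {z : P × X}

theorem IsStableConicSystem.differentiableAt (hs : IsStableConicSystem Γ G K z) :
    DifferentiableAt ℝ G z :=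
  hs.contDiffAt.differentiableAt (by simp)

theorem IsStableConicSystem.hasFDerivAt_fderiv (hs : IsStableConicSystem Γ G K z) :
    HasFDerivAt (fderiv ℝ G) (fderiv ℝ (fderiv ℝ G) z) z :=
  ((hs.contDiffAt.fderiv_right (m := 1) (by norm_num)).differentiableAt (by simp)).hasFDerivAt

theorem IsStableConicSystem.mem (hs : IsStableConicSystem Γ G K z) : z.2 ∈ Γ z.1 :=
  hs.mem_iff.self_of_nhds.2 (by rw [hs.map_eq_zero]; exact K.zero_mem)

/-- As G(z) = 0 and K is a cone, the difference quotients already lie in the closed set K. -/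
theorem IsStableConicSystem.fderiv_mem_of_tendsto (hs : IsStableConicSystem Γ G K z) {t : ℕ → ℝ}
    {w : ℕ → P × X} {v : P × X} (ht : ∀ k, 0 < t k) (ht0 : Tendsto t atTop (𝓝 0))
    (hw : Tendsto w atTop (𝓝 v)) (hmem : ∀ᶠ k in atTop, G (z + t k • w k) ∈ K) :
    fderiv ℝ G z v ∈ K := by
  refine K.isClosed.mem_of_tendsto
    (hs.differentiableAt.hasFDerivAt.tendsto_quotient ht ht0 hw) ?_
  filter_upwards [hmem] with k hk
  rw [hs.map_eq_zero, sub_zero]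
  exact K.smul_mem hk (inv_nonneg.2 (ht k).le)

/-- The tangent cone to the graph of `Γ` is the linearization cone. -/
theorem IsStableConicSystem.mem_tangentCone_iff (hs : IsStableConicSystem Γ G K z) {v : P × X} :
    v ∈ bouligandTangentCone (setValuedGraph Γ) z ↔ fderiv ℝ G z v ∈ K := by
  constructor
  · rintro ⟨-, t, w, ht, ht0, hw, hmem⟩
    refine hs.fderiv_mem_of_tendsto ht ht0 hw ?_
    have hz : Tendsto (fun k => z + t k • w k) atTop (𝓝 z) := by
      simpa using tendsto_const_nhds.add (ht0.smul hw)
    filter_upwards [hz.eventually hs.mem_iff] with k hk using hk.1 (hmem k)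
  · intro hv
    refine mem_bouligandTangentCone_iff.2 ⟨hs.mem, fun ε hε => ?_⟩
    obtain ⟨κ, hκ, hnear⟩ := hs.exists_near
    have hid : Tendsto (fun k : ℕ => (1 : ℝ) / (k + 1)) atTop (𝓝 0) :=
      tendsto_one_div_add_atTop_nhds_zero_nat
    have hpos : ∀ k : ℕ, (0 : ℝ) < 1 / (k + 1) := fun k => Nat.one_div_pos_of_nat
    have hq := hs.differentiableAt.hasFDerivAt.tendsto_quotient hpos hid
      (tendsto_const_nhds (x := v))
    have hr : Tendsto (fun k : ℕ => κ * ‖((1 : ℝ) / (k + 1))⁻¹ •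
        (G (z + ((1 : ℝ) / (k + 1)) • v) - G z) - fderiv ℝ G z v‖ + (1 : ℝ) / (k + 1))
        atTop (𝓝 0) := by
      simpa using ((hq.sub_const (fderiv ℝ G z v)).norm.const_mul κ).add hid
    have hz : Tendsto (fun k : ℕ => z + ((1 : ℝ) / (k + 1)) • v) atTop (𝓝 z) := by
      simpa using tendsto_const_nhds.add (hid.smul_const v)
    obtain ⟨k, h1, h2, h3⟩ := ((hz.eventually hnear).and
      ((hr.eventually (gt_mem_nhds hε)).and (hid.eventually (gt_mem_nhds hε)))).exists
    set t : ℝ := (1 : ℝ) / (k + 1) with ht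
    have htpos : 0 < t := hpos k
    -- Only the X-component is corrected, by o(t); the parameter stays exactly at z.1 + t v.1.
    obtain ⟨x, hx, hle⟩ := h1 (t • fderiv ℝ G z v) (K.smul_mem hv htpos.le) (t * t)
      (by positivity)
    refine ⟨t, htpos, h3, (v.1, t⁻¹ • (x - z.2)), ?_, ?_⟩
    · have hsub : ((v.1, t⁻¹ • (x - z.2)) : P × X) - v =
          (0, t⁻¹ • (x - (z + t • v).2)) := by
        refine Prod.ext (by simp) ?_
        simp only [Prod.snd_sub, Prod.snd_add, Prod.smul_snd, smul_sub, smul_add]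
        rw [smul_smul, inv_mul_cancel₀ htpos.ne', one_smul]
        abel
      rw [hsub, Prod.norm_mk, norm_zero, max_eq_right (norm_nonneg _), norm_smul,
        Real.norm_of_nonneg (inv_nonneg.2 htpos.le)]
      refine lt_of_le_of_lt ?_ h2
      rw [inv_mul_le_iff₀ htpos]
      refine hle.trans (le_of_eq ?_)
      have : G (z + t • v) - t • fderiv ℝ G z v =
          t • (t⁻¹ • (G (z + t • v) - G z) - fderiv ℝ G z v) := by
        rw [smul_sub, smul_smul, mul_inv_cancel₀ htpos.ne', hs.map_eq_zero]
        simp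
      rw [this, norm_smul, Real.norm_of_nonneg htpos.le]
      ring
    · have : z + t • ((v.1, t⁻¹ • (x - z.2)) : P × X) = ((z + t • v).1, x) := by
        refine Prod.ext (by simp) ?_
        simp only [Prod.snd_add, Prod.smul_snd]
        rw [smul_smul, mul_inv_cancel₀ htpos.ne', one_smul]
        abel
      rw [this]
      exact hx

theorem tendsto_clm_comp {U V W : Type*} [NormedAddCommGroup U] [NormedSpace ℝ U]
    [NormedAddCommGroup V] [NormedSpace ℝ V] [NormedAddCommGroup W] [NormedSpace ℝ W]
    {ι : Type*} {l : Filter ι} {S : ι → V →L[ℝ] W} {S₀ : V →L[ℝ] W}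
    {T : ι → U →L[ℝ] V} {T₀ : U →L[ℝ] V} (hS : Tendsto S l (𝓝 S₀)) (hT : Tendsto T l (𝓝 T₀)) :
    Tendsto (fun i => (S i).comp (T i)) l (𝓝 (S₀.comp T₀)) :=
  (isBoundedBilinearMap_comp.continuous.tendsto (S₀, T₀)).comp (hS.prodMk_nhds hT)

/-- Multipliers `μ k` at points `z + t k • w k` of the solution set, where `w k → v`, converge to
`μ₀`, and their images in `X^*` have the directional derivative `η`. -/
structure IsMultiplierSequence (G : P × X → E) (K : ProperCone ℝ E) (z v : P × X)
    (η : StrongDual ℝ X) (t : ℕ → ℝ) (w : ℕ → P × X) (μ : ℕ → StrongDual ℝ E)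
    (μ₀ : StrongDual ℝ E) : Prop where
  pos : ∀ k, 0 < t k
  tendsto_zero : Tendsto t atTop (𝓝 0)
  tendsto_dir : Tendsto w atTop (𝓝 v)
  map_mem : ∀ k, G (z + t k • w k) ∈ K
  mem_polar : ∀ k, μ k ∈ polarCone (K : Set E)
  apply_eq_zero : ∀ k, μ k (G (z + t k • w k)) = 0
  tendsto_multiplier : Tendsto μ atTop (𝓝 μ₀)
  tendsto_quotient : Tendsto (fun k => (t k)⁻¹ •
    (μ k - μ₀).comp ((fderiv ℝ G z).comp (ContinuousLinearMap.inr ℝ P X))) atTop (𝓝 η)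

namespace IsMultiplierSequence

variable {v : P × X} {η : StrongDual ℝ X} {t : ℕ → ℝ} {w : ℕ → P × X} {μ : ℕ → StrongDual ℝ E}
  {μ₀ : StrongDual ℝ E}

theorem subseq (h : IsMultiplierSequence G K z v η t w μ μ₀) {φ : ℕ → ℕ} (hφ : StrictMono φ) :
    IsMultiplierSequence G K z v η (t ∘ φ) (w ∘ φ) (μ ∘ φ) μ₀ where
  pos _ := h.pos _
  tendsto_zero := h.tendsto_zero.comp hφ.tendsto_atTop
  tendsto_dir := h.tendsto_dir.comp hφ.tendsto_atTop
  map_mem _ := h.map_mem _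
  mem_polar _ := h.mem_polar _
  apply_eq_zero _ := h.apply_eq_zero _
  tendsto_multiplier := h.tendsto_multiplier.comp hφ.tendsto_atTop
  tendsto_quotient := h.tendsto_quotient.comp hφ.tendsto_atTop

theorem limit_mem_polar (h : IsMultiplierSequence G K z v η t w μ μ₀) :
    μ₀ ∈ polarCone (K : Set E) := fun e he =>
  le_of_tendsto' (tendsto_clm_apply h.tendsto_multiplier (tendsto_const_nhds (x := e)))
    fun k => h.mem_polar k e he

/-- Complementarity μ_k(G(z + t_k w_k)) = 0, divided by t_k, in the limit. -/
theorem limit_apply_eq_zero (h : IsMultiplierSequence G K z v η t w μ μ₀)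
    (hs : IsStableConicSystem Γ G K z) : μ₀ (fderiv ℝ G z v) = 0 := by
  have h1 := tendsto_clm_apply h.tendsto_multiplier
    (hs.differentiableAt.hasFDerivAt.tendsto_quotient h.pos h.tendsto_zero h.tendsto_dir)
  refine tendsto_nhds_unique h1 (tendsto_const_nhds.congr fun k => ?_)
  rw [hs.map_eq_zero, sub_zero, map_smul, h.apply_eq_zero, smul_zero]

theorem fderiv_mem (h : IsMultiplierSequence G K z v η t w μ μ₀)
    (hs : IsStableConicSystem Γ G K z) : fderiv ℝ G z v ∈ K :=
  hs.fderiv_mem_of_tendsto h.pos h.tendsto_zero h.tendsto_dir (.of_forall h.map_mem)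

/-- The conclusion drawn from a sequence of multipliers: the limit is a maximizing multiplier, and
`η` is the projection of a normal to the critical cone. -/
def Conclusion (G : P × X → E) (K : ProperCone ℝ E) (z v : P × X) (η : StrongDual ℝ X)
    (μ₀ : StrongDual ℝ E) : Prop :=
  (∀ μ' ∈ polarCone (K : Set E), μ'.comp (fderiv ℝ G z) = μ₀.comp (fderiv ℝ G z) →
    μ' (fderiv ℝ (fderiv ℝ G) z v v) ≤ μ₀ (fderiv ℝ (fderiv ℝ G) z v v)) ∧
  ∃ ws : StrongDual ℝ (P × X),
    (∀ y, fderiv ℝ G z y ∈ K → μ₀ (fderiv ℝ G z y) = 0 → ws y ≤ 0) ∧ ws v = 0 ∧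
      ws.comp (ContinuousLinearMap.inr ℝ P X) = η

/-- If the parameter derivative factors through the `X`-derivative modulo the lineality space of
`K`, then the whole functionals converge. -/
theorem conclusion_of_factor (h : IsMultiplierSequence G K z v η t w μ μ₀)
    (hs : IsStableConicSystem Γ G K z) (L : P →L[ℝ] X)
    (hL : ∀ ν ∈ polarCone (K : Set E), ∀ q, ν (fderiv ℝ G z (q, 0)) = ν (fderiv ℝ G z (0, L q))) :
    Conclusion G K z v η μ₀ := by
  set A := fderiv ℝ G z with hA
  set b := fderiv ℝ (fderiv ℝ G) z v v with hb
  set ηk : ℕ → StrongDual ℝ X := fun k => (t k)⁻¹ •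
    (μ k - μ₀).comp (A.comp (ContinuousLinearMap.inr ℝ P X)) with hηk
  -- Through A, polar functionals do not distinguish (q,u) from (0, Lq + u). Hence η(Lq + u) is the
  -- limit of the full quotients t_k⁻¹(μ_k − μ₀)(A(q,u)).
  set ws : StrongDual ℝ (P × X) := η.comp
    (L.comp (ContinuousLinearMap.fst ℝ P X) + ContinuousLinearMap.snd ℝ P X) with hws
  have hfac : ∀ ν ∈ polarCone (K : Set E), ∀ y : P × X, ν (A y) = ν (A (0, L y.1 + y.2)) := by
    intro ν hν y
    have h1 : y = (y.1, 0) + (0, y.2) := by simp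
    have h2 : ((0, L y.1 + y.2) : P × X) = (0, L y.1) + (0, y.2) := by simp
    rw [h2, map_add, map_add, ← hL ν hν, ← map_add, ← map_add, ← h1]
  have hηapp : ∀ k y, ηk k (L y.1 + y.2) = (t k)⁻¹ * (μ k (A y) - μ₀ (A y)) := by
    intro k y
    simp only [hηk, smul_apply, ContinuousLinearMap.comp_apply, sub_apply, smul_eq_mul,
      ContinuousLinearMap.inr_apply]
    rw [hfac _ (h.mem_polar k) y, hfac _ h.limit_mem_polar y]
  have hlim : ∀ {y : ℕ → P × X} {y₀ : P × X}, Tendsto y atTop (𝓝 y₀) →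
      Tendsto (fun k => (t k)⁻¹ * (μ k (A (y k)) - μ₀ (A (y k)))) atTop (𝓝 (ws y₀)) := by
    intro y y₀ hy
    have hy' : Tendsto (fun k => L (y k).1 + (y k).2) atTop (𝓝 (L y₀.1 + y₀.2)) :=
      (Continuous.tendsto (by fun_prop : Continuous fun y : P × X => L y.1 + y.2) y₀).comp hy
    exact (tendsto_clm_apply h.tendsto_quotient hy').congr fun k => hηapp k (y k)
  have hcrit : ∀ y, A y ∈ K → μ₀ (A y) = 0 → ws y ≤ 0 := by
    intro y hy hy0
    refine le_of_tendsto' (hlim (tendsto_const_nhds (x := y))) fun k => ?_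
    rw [hy0, sub_zero]
    exact mul_nonpos_of_nonneg_of_nonpos (inv_nonneg.2 (h.pos k).le) (h.mem_polar k _ hy)
  have hR := hs.contDiffAt.tendsto_second_order_quotient (.of_forall h.pos) h.tendsto_zero
    h.tendsto_dir
  -- From μ_k(G) = 0 ≥ μ'(G) at z + t_k w_k, divided by t_k². The first-order terms of μ' and μ₀
  -- agree, so only the quotient converging to `ws v` survives beside the second-order term.
  have hkey : ∀ μ' ∈ polarCone (K : Set E), μ'.comp A = μ₀.comp A →
      0 ≤ (μ₀ - μ') ((1 / 2 : ℝ) • b) + ws v := by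
    intro μ' hμ' heq
    refine ge_of_tendsto' ((tendsto_clm_apply (h.tendsto_multiplier.sub_const μ') hR).add
      (hlim h.tendsto_dir)) fun k => ?_
    have h1 : μ' (A (w k)) = μ₀ (A (w k)) := congrArg (fun ν : StrongDual ℝ (P × X) => ν (w k)) heq
    have h2 : μ' (G (z + t k • w k)) ≤ 0 := hμ' _ (h.map_mem k)
    have h3 := h.apply_eq_zero k
    have ht := h.pos k
    simp only [sub_apply, hs.map_eq_zero, sub_zero, map_smul, map_sub, smul_eq_mul]
    rw [h3, ← hA, h1]
    have h4 : (t k ^ 2)⁻¹ * (0 - μ' (G (z + t k • w k)) -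
        t k * (μ k (A (w k)) - μ₀ (A (w k)))) +
        (t k)⁻¹ * (μ k (A (w k)) - μ₀ (A (w k))) =
        (t k ^ 2)⁻¹ * -μ' (G (z + t k • w k)) := by
      field_simp
      ring
    rw [h4]
    exact mul_nonneg (by positivity) (by linarith)
  have hwsv : ws v = 0 := by
    refine le_antisymm (hcrit v (h.fderiv_mem hs) (h.limit_apply_eq_zero hs)) ?_
    simpa using hkey μ₀ h.limit_mem_polar rfl
  refine ⟨fun μ' hμ' heq => ?_, ws, hcrit, hwsv, ?_⟩
  · have := hkey μ' hμ' heq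
    rw [hwsv, add_zero, map_smul, sub_apply, smul_eq_mul] at this
    linarith
  · ext u
    simp [hws]

/-- For polyhedral cones, the multipliers can be kept in a fixed face. -/
theorem conclusion_of_polyhedral [FiniteDimensional ℝ E]
    (h : IsMultiplierSequence G K z v η t w μ μ₀)
    (hs : IsStableConicSystem Γ G K z) {ι : Type*} (s : Finset ι) (a : ι → StrongDual ℝ E)
    (hK : ∀ e, e ∈ K ↔ ∀ i ∈ s, a i e ≤ 0) : Conclusion G K z v η μ₀ := by
  classical
  -- There are finitely many active index sets, so one of them recurs along a subsequence.
  obtain ⟨I, φ, hφ, hI⟩ : ∃ I : Finset ι, ∃ φ : ℕ → ℕ, StrictMono φ ∧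
      ∀ k, s.filter (fun i => a i (G (z + t (φ k) • w (φ k))) = 0) = I := by
    obtain ⟨I, hI⟩ := Finite.exists_infinite_fiber (fun k : ℕ =>
      (⟨s.filter (fun i => a i (G (z + t k • w k)) = 0), by simp⟩ : s.powerset))
    obtain ⟨φ, hφ, hφI⟩ := extraction_of_frequently_atTop
      (Nat.frequently_atTop_iff_infinite.2 (Set.infinite_coe_iff.1 hI))
    exact ⟨I, φ, hφ, fun k => congrArg Subtype.val (hφI k)⟩
  replace h := h.subseq hφ
  replace hI : ∀ k, s.filter (fun i =>
    a i (G (z + (t ∘ φ) k • (w ∘ φ) k)) = 0) = I := hI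
  generalize t ∘ φ = t, w ∘ φ = w, μ ∘ φ = μ at h hI
  clear φ hφ
  set A := fderiv ℝ G z with hA
  have hIs : I ⊆ s := by rw [← hI 0]; exact Finset.filter_subset _ _
  have hpol : ∀ ν ∈ finiteCone I a, ν ∈ polarCone (K : Set E) := by
    rintro _ ⟨c, hc, rfl⟩ e he
    simp only [FunLike.coe_sum, Finset.sum_apply, smul_apply, smul_eq_mul]
    exact Finset.sum_nonpos fun i hi =>
      mul_nonpos_of_nonneg_of_nonpos (hc i) ((hK e).1 he i (hIs hi))
  have hzero : ∀ ν ∈ finiteCone I a, ∀ k, ν (G (z + t k • w k)) = 0 := by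
    rintro _ ⟨c, hc, rfl⟩ k
    simp only [FunLike.coe_sum, Finset.sum_apply, smul_apply, smul_eq_mul]
    refine Finset.sum_eq_zero fun i hi => ?_
    rw [← hI k, Finset.mem_filter] at hi
    rw [hi.2, mul_zero]
  have hdir : ∀ ν ∈ finiteCone I a, ν (A v) = 0 := by
    intro ν hν
    have h1 := tendsto_clm_apply (tendsto_const_nhds (x := ν))
      (hs.differentiableAt.hasFDerivAt.tendsto_quotient h.pos h.tendsto_zero h.tendsto_dir)
    refine tendsto_nhds_unique h1 (tendsto_const_nhds.congr fun k => ?_)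
    rw [hs.map_eq_zero, sub_zero, map_smul, hzero ν hν, smul_zero]
  -- By Farkas μ_k is generated by the constraints; complementarity kills the coefficients of the
  -- inactive ones.
  have hμI : ∀ k, μ k ∈ finiteCone I a := by
    intro k
    have h1 : μ k ∈ finiteCone s a := mem_finiteCone_of_forall_le fun e he =>
      h.mem_polar k e ((hK e).2 he)
    obtain ⟨c, hc, hsum⟩ := h1
    have h2 := h.apply_eq_zero k
    rw [← hsum] at h2
    simp only [FunLike.coe_sum, Finset.sum_apply, smul_apply, smul_eq_mul] at h2
    have h3 := (Finset.sum_eq_zero_iff_of_nonpos fun i hi =>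
      mul_nonpos_of_nonneg_of_nonpos (hc i) ((hK _).1 (h.map_mem k) i hi)).1 h2
    refine ⟨c, hc, ?_⟩
    rw [← hsum, ← hI k]
    refine Finset.sum_subset (Finset.filter_subset _ _) fun i hi hni => ?_
    have h4 : c i = 0 := by
      rcases mul_eq_zero.1 (h3 i hi) with h0 | h0
      · exact h0
      · exact absurd (Finset.mem_filter.2 ⟨hi, h0⟩) hni
    rw [h4, zero_smul]
  have hμ₀I : μ₀ ∈ finiteCone I a :=
    (isClosed_finiteCone I a).mem_of_tendsto h.tendsto_multiplier (.of_forall hμI)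
  constructor
  · intro μ' hμ' heq
    have hR := hs.contDiffAt.tendsto_second_order_quotient (.of_forall h.pos) h.tendsto_zero
      h.tendsto_dir
    -- Here μ₀ itself vanishes at the points G(z + t_k w_k), being in the face of `I`, so μ' is
    -- compared with μ₀ directly.
    have h1 : (μ' - μ₀) ((1 / 2 : ℝ) • fderiv ℝ (fderiv ℝ G) z v v) ≤ 0 := by
      refine le_of_tendsto' (tendsto_clm_apply (tendsto_const_nhds (x := μ' - μ₀)) hR)
        fun k => ?_
      have h1 : μ' (A (w k)) = μ₀ (A (w k)) :=
        congrArg (fun ν : StrongDual ℝ (P × X) => ν (w k)) heq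
      have h2 : μ' (G (z + t k • w k)) ≤ 0 := hμ' _ (h.map_mem k)
      have h3 := hzero μ₀ hμ₀I k
      simp only [sub_apply, hs.map_eq_zero, sub_zero, map_smul, map_sub, smul_eq_mul]
      rw [h3, ← hA, h1]
      rw [sub_self, mul_zero, sub_zero, sub_zero]
      exact mul_nonpos_of_nonneg_of_nonpos (by positivity) h2
    rw [map_smul, sub_apply, smul_eq_mul] at h1
    linarith
  · set T : StrongDual ℝ E →L[ℝ] StrongDual ℝ X := (ContinuousLinearMap.compL ℝ X E ℝ).flip
      (A.comp (ContinuousLinearMap.inr ℝ P X)) with hT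
    obtain ⟨ν, hν, r, hr, hη⟩ := (isClosed_image_finiteCone_sub_ray I a T
      (T μ₀)).mem_of_tendsto h.tendsto_quotient (.of_forall fun k => by
        refine ⟨(t k)⁻¹ • μ k, smul_mem_finiteCone (hμI k) (inv_nonneg.2 (h.pos k).le),
          (t k)⁻¹, inv_nonneg.2 (h.pos k).le, ?_⟩
        rw [map_smul]
        ext u
        exact mul_sub (t k)⁻¹ _ _)
    -- The limit is T(ν − rμ₀) with ν and μ₀ in the face of `I`. Both vanish at Av, and on the
    -- critical cone ν is nonpositive and μ₀ is zero.
    refine ⟨(ν - r • μ₀).comp A, fun y hy hy0 => ?_, ?_, ?_⟩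
    · have h1 : ν (A y) ≤ 0 := hpol ν hν _ hy
      have h2 : μ₀ (A y) = 0 := hy0
      simp [h1, h2]
    · simp [hdir ν hν, hdir μ₀ hμ₀I]
    · rw [hη, ← map_smul, ← map_sub]
      rfl

end IsMultiplierSequence

/-- Tangents to the graph of the normal cone mapping are generated by sequences of multipliers. -/
theorem IsStableConicSystem.exists_isMultiplierSequence [FiniteDimensional ℝ X]
    [FiniteDimensional ℝ E] (hs : IsStableConicSystem Γ G K z) {N : NormalConeKind} {v : P × X}
    {xs us : StrongDual ℝ X}
    (h : (v, us) ∈ bouligandTangentCone (setValuedGraph (normalConeMapping N Γ)) (z, xs)) :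
    ∃ t w μ μ₀, IsMultiplierSequence G K z v
        (us - (μ₀.comp (fderiv ℝ (fderiv ℝ G) z v)).comp (ContinuousLinearMap.inr ℝ P X))
        t w μ μ₀ ∧
      μ₀.comp ((fderiv ℝ G z).comp (ContinuousLinearMap.inr ℝ P X)) = xs := by
  obtain ⟨-, t, wk, ht, ht0, hwk, hmem⟩ := h
  obtain ⟨κ, hκ, hmult⟩ := hs.exists_multiplier N
  have hw : Tendsto (fun k => (wk k).1) atTop (𝓝 v) := (continuous_fst.tendsto _).comp hwk
  have hu : Tendsto (fun k => (wk k).2) atTop (𝓝 us) := (continuous_snd.tendsto _).comp hwk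
  have hz : Tendsto (fun k => z + t k • (wk k).1) atTop (𝓝 z) := by
    simpa using tendsto_const_nhds.add (ht0.smul hw)
  have hxs : Tendsto (fun k => xs + t k • (wk k).2) atTop (𝓝 xs) := by
    simpa using tendsto_const_nhds.add (ht0.smul hu)
  have hmem' : ∀ k, xs + t k • (wk k).2 ∈
      normalCone N (Γ (z + t k • (wk k).1).1) (z + t k • (wk k).1).2 := hmem
  obtain ⟨k₀, hk₀⟩ := eventually_atTop.1 (hz.eventually (hmult.and hs.mem_iff))
  have hex := fun k => (hk₀ (k + k₀) (Nat.le_add_left _ _)).1 _ (hmem' (k + k₀))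
  choose μ hμK hμ0 hμle hμeq using hex
  have : ProperSpace (StrongDual ℝ E) := FiniteDimensional.proper ℝ _
  obtain ⟨R, hR⟩ := (hxs.norm.comp (tendsto_add_atTop_nat k₀)).bddAbove_range
  obtain ⟨μ₀, -, φ, hφ, hμlim⟩ := tendsto_subseq_of_bounded
    (Metric.isBounded_closedBall (x := (0 : StrongDual ℝ E)) (r := κ * R)) (x := μ) (fun k => by
      rw [mem_closedBall_zero_iff]
      refine (hμle k).trans ?_
      gcongr
      exact hR ⟨k, rfl⟩)
  have hshift : Tendsto (fun k => φ k + k₀) atTop atTop :=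
    (tendsto_add_atTop_nat k₀).comp hφ.tendsto_atTop
  set i := ContinuousLinearMap.inr ℝ P X with hi
  have hA : Tendsto (fun k => (fderiv ℝ G (z + t (φ k + k₀) • (wk (φ k + k₀)).1)).comp i)
      atTop (𝓝 ((fderiv ℝ G z).comp i)) :=
    tendsto_clm_comp (hs.hasFDerivAt_fderiv.continuousAt.tendsto.comp (hz.comp hshift))
      tendsto_const_nhds
  have hlim0 : μ₀.comp ((fderiv ℝ G z).comp i) = xs :=
    tendsto_nhds_unique ((tendsto_clm_comp hμlim hA).congr fun k => hμeq (φ k))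
      (hxs.comp hshift)
  refine ⟨fun k => t (φ k + k₀), fun k => (wk (φ k + k₀)).1, fun k => μ (φ k), μ₀, ?_, hlim0⟩
  refine ⟨fun k => ht _, ht0.comp hshift, hw.comp hshift, fun k =>
    (hk₀ _ (Nat.le_add_left _ _)).2.1 (mem_of_mem_normalCone (hmem' (φ k + k₀))),
    fun k => hμK _, fun k => hμ0 _, hμlim, ?_⟩
  have hq := hs.hasFDerivAt_fderiv.tendsto_quotient (fun k => ht (φ k + k₀)) (ht0.comp hshift)
    (hw.comp hshift)
  -- The product rule in discrete form: since xs = μ₀ ∘ ∇ₓG(z), removing t⁻¹μ_k(∇ₓG(z + tw) −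
  -- ∇ₓG(z)) from the dual direction leaves t⁻¹(μ_k − μ₀) ∘ ∇ₓG(z).
  have h1 := (hu.comp hshift).sub
    (tendsto_clm_comp (tendsto_clm_comp hμlim hq) (tendsto_const_nhds (x := i)))
  refine h1.congr fun k => ?_
  have htk := (ht (φ k + k₀)).ne'
  have h2 := hμeq (φ k)
  ext u
  have h3 : μ (φ k) (fderiv ℝ G (z + t (φ k + k₀) • (wk (φ k + k₀)).1) (i u)) =
      xs u + t (φ k + k₀) * (wk (φ k + k₀)).2 u :=
    congrArg (fun ν : StrongDual ℝ X => ν u) h2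
  have h4 : μ₀ (fderiv ℝ G z (i u)) = xs u := congrArg (fun ν : StrongDual ℝ X => ν u) hlim0
  simp only [Function.comp, sub_apply, smul_apply, ContinuousLinearMap.comp_apply, smul_eq_mul,
    map_smul, map_sub, ← hi, h3, h4]
  field_simp
  ring

theorem IsStableConicSystem.partialP_eq (hs : IsStableConicSystem Γ G K z) (q : P) :
    partialP G z q = fderiv ℝ G z (q, 0) := by
  have h : HasFDerivAt (fun p => G (p, z.2)) _ z.1 :=
    HasFDerivAt.comp (f := fun p => (p, z.2)) z.1 hs.differentiableAt.hasFDerivAt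
      (hasFDerivAt_prodMk_left z.1 z.2)
  rw [partialP, h.fderiv]
  rfl

theorem IsStableConicSystem.partialX_eq (hs : IsStableConicSystem Γ G K z) (u : X) :
    partialX G z u = fderiv ℝ G z (0, u) := by
  rw [partialX, hs.differentiableAt.hasFDerivAt.comp_prodMk_left.fderiv]
  rfl

/-- If the characteristic subspace is the whole parameter space, then the parameter derivative
factors through the `X`-derivative modulo the lineality space. -/
theorem IsStableConicSystem.exists_factor [FiniteDimensional ℝ P]
    (hs : IsStableConicSystem Γ G K z) (hP : characteristicSubspace G K z = univ) :
    ∃ L : P →L[ℝ] X, ∀ ν ∈ polarCone (K : Set E), ∀ q,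
      ν (fderiv ℝ G z (q, 0)) = ν (fderiv ℝ G z (0, L q)) := by
  have hex : ∀ q : P, ∃ u : X, ∃ e ∈ (K : PointedCone ℝ E).lineal,
      partialP G z q = partialX G z u + e := fun q => by
    have : q ∈ characteristicSubspace G K z := by rw [hP]; trivial
    exact this
  choose u e he heq using hex
  -- The chosen solutions need not depend linearly on q, so they are kept on a basis only. Polar
  -- functionals vanish on the lineality space, so the identity there extends linearly.
  set bs := Module.finBasis ℝ P with hbs
  refine ⟨LinearMap.toContinuousLinearMap (bs.constr ℝ fun i => u (bs i)), fun ν hν q => ?_⟩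
  set L := bs.constr ℝ fun i => u (bs i) with hL
  have hlin : ν.toLinearMap ∘ₗ (fderiv ℝ G z).toLinearMap ∘ₗ LinearMap.inl ℝ P X =
      ν.toLinearMap ∘ₗ (fderiv ℝ G z).toLinearMap ∘ₗ LinearMap.inr ℝ P X ∘ₗ L := by
    refine bs.ext fun i => ?_
    have h1 := heq (bs i)
    rw [hs.partialP_eq, hs.partialX_eq] at h1
    have h2 := PointedCone.mem_lineal.1 (he (bs i))
    have h3 : ν (e (bs i)) = 0 := by
      refine le_antisymm (hν _ h2.1) ?_
      have := hν _ h2.2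
      rw [map_neg] at this
      linarith
    have h4 : L (bs i) = u (bs i) := bs.constr_basis ℝ _ i
    simp only [LinearMap.comp_apply, LinearMap.inl_apply, LinearMap.inr_apply,
      ContinuousLinearMap.coe_coe, h4]
    rw [h1, map_add, h3, add_zero]
  exact LinearMap.congr_fun hlin q

/-- Invariance under scaling lets every right-hand side be replaced by zero: large multiples give
one direction, and 0 ∈ K makes the right-hand sides nonnegative for the other. -/
theorem ProperCone.mem_iff_of_isPolyhedralSet (K : ProperCone ℝ E)
    {s : Finset (StrongDual ℝ E × ℝ)} (h : (K : Set E) = {e | ∀ c ∈ s, c.1 e ≤ c.2}) (e : E) :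
    e ∈ K ↔ ∀ c ∈ s, c.1 e ≤ 0 := by
  have hmem : ∀ e, e ∈ K ↔ ∀ c ∈ s, c.1 e ≤ c.2 := fun e => by
    rw [← SetLike.mem_coe, h]; rfl
  constructor
  · intro he c hc
    refine nonpos_of_forall_mul_le (c := c.2) fun r hr => ?_
    simpa using (hmem _).1 (K.smul_mem he hr.le) c hc
  · intro he
    have h0 := (hmem 0).1 K.zero_mem
    refine (hmem e).2 fun c hc => (he c hc).trans ?_
    simpa using h0 c hc

/-- The upper estimate of the tangent cone to the graph of the normal cone mapping. -/
theorem IsStableConicSystem.exists_of_mem_tangentCone [FiniteDimensional ℝ P]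
    [FiniteDimensional ℝ X] [FiniteDimensional ℝ E] (hs : IsStableConicSystem Γ G K z)
    (hPK : characteristicSubspace G K z = univ ∨ IsPolyhedralSet (K : Set E))
    {N : NormalConeKind} {v : P × X} {xs us : StrongDual ℝ X}
    (h : (v, us) ∈ bouligandTangentCone (setValuedGraph (normalConeMapping N Γ)) (z, xs)) :
    ∃ μ₀ ∈ polarCone (K : Set E), fderiv ℝ G z v ∈ K ∧ μ₀ (fderiv ℝ G z v) = 0 ∧
      μ₀.comp ((fderiv ℝ G z).comp (ContinuousLinearMap.inr ℝ P X)) = xs ∧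
      IsMultiplierSequence.Conclusion G K z v
        (us - (μ₀.comp (fderiv ℝ (fderiv ℝ G) z v)).comp (ContinuousLinearMap.inr ℝ P X)) μ₀ := by
  obtain ⟨t, w, μ, μ₀, hseq, hxs⟩ := hs.exists_isMultiplierSequence h
  refine ⟨μ₀, hseq.limit_mem_polar, hseq.fderiv_mem hs, hseq.limit_apply_eq_zero hs, hxs, ?_⟩
  rcases hPK with hP | ⟨s, hK⟩
  · obtain ⟨L, hL⟩ := hs.exists_factor hP
    exact hseq.conclusion_of_factor hs L hL
  · exact hseq.conclusion_of_polyhedral hs s Prod.fst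
      (ProperCone.mem_iff_of_isPolyhedralSet K hK)

end StableSystem

/-! ### Asymptotic duality for conic programs. -/

section Duality

variable {Z E : Type*} [NormedAddCommGroup Z] [NormedSpace ℝ Z]
  [NormedAddCommGroup E] [NormedSpace ℝ E]

/-- Asymptotic strong duality: if `μ₀` maximizes `⟨μ, b⟩` over the multipliers with the same image
under `A^*`, then the dual conic program has approximately feasible and approximately optimal
points. -/
theorem exists_approx_dual_solution (K : ProperCone ℝ E) (A : Z →L[ℝ] E) (b : E)
    {μ₀ : StrongDual ℝ E} (hμ₀ : μ₀ ∈ polarCone (K : Set E))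
    (hmax : ∀ μ' ∈ polarCone (K : Set E), μ'.comp A = μ₀.comp A → μ' b ≤ μ₀ b)
    {ε : ℝ} (hε : 0 < ε) :
    ∃ w : Z, ∃ k ∈ K, ‖A w + b - k‖ < ε ∧ -μ₀ (A w) ≤ μ₀ b + ε := by
  -- Pairs of a perturbation and an attainable upper value of the dual program. The claim says that
  -- (b, μ₀ b) is in the closure; closedness of `S`, hence a constraint qualification, is not
  -- needed.
  set S : Set (E × ℝ) := {y | ∃ k ∈ K, ∃ w : Z, ∃ α : ℝ, 0 ≤ α ∧
    (k - A w, -μ₀ (A w) + α) = y} with hS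
  have hSconv : Convex ℝ S := by
    rintro _ ⟨k, hk, w, α, hα, rfl⟩ _ ⟨k', hk', w', α', hα', rfl⟩ r s hr hs -
    refine ⟨r • k + s • k', K.add_mem (K.smul_mem hk hr) (K.smul_mem hk' hs), r • w + s • w',
      r * α + s * α', by positivity, Prod.ext ?_ ?_⟩
    · simp only [map_add, map_smul, Prod.fst_add, Prod.smul_fst]
      module
    · simp only [map_add, map_smul, Prod.snd_add, Prod.smul_snd, smul_eq_mul]
      ring
  have hmem : (b, μ₀ b) ∈ closure S := by
    by_contra hnot
    obtain ⟨f, u, hf, hu⟩ := geometric_hahn_banach_closed_point hSconv.closure isClosed_closure hnot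
    set ν : StrongDual ℝ E := f.comp (ContinuousLinearMap.inl ℝ E ℝ) with hν
    set l : ℝ := f (0, 1) with hl
    have hfapp : ∀ e r, f (e, r) = ν e + r * l := fun e r => by
      have h1 : ((e, r) : E × ℝ) = (e, 0) + r • (0, 1) := by simp
      rw [h1, map_add, map_smul, smul_eq_mul]
      rfl
    have hfS : ∀ k ∈ K, ∀ w : Z, ∀ α : ℝ, 0 ≤ α →
        ν k - ν (A w) + (-μ₀ (A w) + α) * l < u := fun k hk w α hα => by
      have := hf _ (subset_closure ⟨k, hk, w, α, hα, rfl⟩)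
      rwa [hfapp, map_sub] at this
    rw [hfapp] at hu
    have hu0 : 0 < u := by simpa using hfS 0 K.zero_mem 0 0 le_rfl
    have hνK : ∀ k ∈ K, ν k ≤ 0 := fun k hk => nonpos_of_forall_mul_le (c := u) fun s hs => by
      simpa using (hfS (s • k) (K.smul_mem hk hs.le) 0 0 le_rfl).le
    have hl0 : l ≤ 0 := nonpos_of_forall_mul_le (c := u) fun s hs => by
      simpa using (hfS 0 K.zero_mem 0 s hs.le).le
    have hle : ∀ w, -(ν (A w) + l * μ₀ (A w)) ≤ 0 := fun w =>
      nonpos_of_forall_mul_le (c := u) fun s hs => by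
        have := (hfS 0 K.zero_mem (s • w) 0 le_rfl).le
        simp only [map_zero, map_smul, smul_eq_mul] at this
        linarith
    have heq : ∀ w, ν (A w) = -l * μ₀ (A w) := fun w => by
      have h1 := hle w
      have h2 := hle (-w)
      simp only [map_neg] at h2
      linarith
    have hpos : 0 < 1 - l := by linarith
    -- The separating functional (ν, l) has ν ∈ K*, l ≤ 0 and ν ∘ A = −l μ₀ ∘ A. Adding μ₀ before
    -- normalizing keeps the divisor 1 − l positive even when l = 0; the result is a multiplier with
    -- a value above μ₀ b.
    have h1 := hmax ((1 - l)⁻¹ • (ν + μ₀)) (fun e he => by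
      have ha := hνK e he
      have hb := hμ₀ e he
      exact mul_nonpos_of_nonneg_of_nonpos (inv_nonneg.2 hpos.le) (add_nonpos ha hb)) (by
        ext w
        simp only [ContinuousLinearMap.comp_apply, smul_apply, add_apply, smul_eq_mul, heq]
        field_simp
        ring)
    rw [smul_apply, smul_eq_mul, inv_mul_le_iff₀ hpos, add_apply] at h1
    linarith
  obtain ⟨_, ⟨k, hk, w, α, hα, rfl⟩, hdist⟩ := Metric.mem_closure_iff.1 hmem ε hε
  rw [Prod.dist_eq, max_lt_iff, dist_eq_norm, Real.dist_eq] at hdist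
  refine ⟨w, k, hk, ?_, ?_⟩
  · have : A w + b - k = b - (k - A w) := by abel
    rw [this]
    exact hdist.1
  · have := (abs_lt.1 hdist.2).1
    linarith

end Duality

/-! ### The lower estimate by regularized minimization. -/

section LowerEstimate

variable {P X E : Type*} [NormedAddCommGroup P] [NormedSpace ℝ P]
  [NormedAddCommGroup X] [InnerProductSpace ℝ X]
  [NormedAddCommGroup E] [InnerProductSpace ℝ E]
  {Γ : P → Set X} {G : P × X → E} {K : ProperCone ℝ E} {z : P × X}

theorem exists_seq_of_eventually_nhdsGT {D : Type*} {Q : ℝ → D → Prop}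
    (h : ∀ᶠ t in 𝓝[>] (0 : ℝ), ∃ d, Q t d) :
    ∃ (t : ℕ → ℝ) (d : ℕ → D), (∀ n, 0 < t n) ∧ Tendsto t atTop (𝓝 0) ∧ ∀ n, Q (t n) (d n) := by
  obtain ⟨t, ht⟩ := exists_seq_tendsto (𝓝[>] (0 : ℝ))
  obtain ⟨n₀, hn₀⟩ := eventually_atTop.1 (ht.eventually (h.and self_mem_nhdsWithin))
  choose d hd using fun n => (hn₀ (n + n₀) (Nat.le_add_left _ _)).1
  exact ⟨fun n => t (n + n₀), d, fun n => (hn₀ (n + n₀) (Nat.le_add_left _ _)).2,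
    (tendsto_add_atTop_iff_nat n₀).2 (ht.mono_right nhdsWithin_le_nhds), hd⟩

/-- A local minimizer of a quadratically regularized linear functional has a regular normal. -/
theorem mem_regularNormalCone_of_isMinOn {S : Set X} {x c : X} {l : StrongDual ℝ X} {ρ : ℝ}
    (hρ : 0 < ρ) (hx : x ∈ S)
    (hmin : ∀ᶠ y in 𝓝[S] x, -l (x - c) + ρ / 2 * ‖x - c‖ ^ 2 ≤ -l (y - c) + ρ / 2 * ‖y - c‖ ^ 2) :
    l - ρ • innerSL ℝ (x - c) ∈ regularNormalCone S x := by
  refine ⟨hx, fun ε hε => ?_⟩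
  -- Within this radius (ρ/2)‖y − x‖² ≤ ε‖y − x‖.
  have hball : ∀ᶠ y in 𝓝[S] x, ‖y - x‖ < 2 * ε / ρ := by
    filter_upwards [nhdsWithin_le_nhds (Metric.ball_mem_nhds x (by positivity : 0 < 2 * ε / ρ))]
      with y hy
    rwa [← dist_eq_norm]
  filter_upwards [hmin, hball] with y hy hyx
  have h1 : ‖y - c‖ ^ 2 = ‖x - c‖ ^ 2 + 2 * inner ℝ (x - c) (y - x) + ‖y - x‖ ^ 2 := by
    rw [← norm_add_sq_real]
    congr 2
    abel
  have h2 : l (y - c) = l (x - c) + l (y - x) := by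
    rw [← map_add]
    congr 1
    abel
  have h3 : ρ * ‖y - x‖ ≤ 2 * ε := by
    rw [lt_div_iff₀ hρ] at hyx
    linarith
  have h4 : ρ * ‖y - x‖ * ‖y - x‖ ≤ 2 * ε * ‖y - x‖ :=
    mul_le_mul_of_nonneg_right h3 (norm_nonneg _)
  rw [h1, h2] at hy
  simp only [sub_apply, smul_apply, innerSL_apply_apply, smul_eq_mul]
  nlinarith

/-- Points of the solution set near a second-order approximate solution. -/
theorem IsStableConicSystem.exists_recovery (hs : IsStableConicSystem Γ G K z) {κ : ℝ}
    (hκ : 0 ≤ κ) (hnear : ∀ᶠ y in 𝓝 z, ∀ k ∈ K, ∀ ε > 0,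
      ∃ x ∈ Γ y.1, ‖x - y.2‖ ≤ κ * ‖G y - k‖ + ε)
    {v w : P × X} {k : E} (hk : k ∈ K) {ε : ℝ} (hε : 0 < ε) (hv : fderiv ℝ G z v ∈ K)
    (hw : ‖fderiv ℝ G z w + fderiv ℝ (fderiv ℝ G) z v v - k‖ < ε) :
    ∀ᶠ t in 𝓝[>] (0 : ℝ), ∃ x ∈ Γ (z.1 + t • (v.1 + (t / 2) • w.1)),
      ‖x - (z.2 + t • (v.2 + (t / 2) • w.2))‖ ≤ t ^ 2 * ((κ + 1) * ε) := by
  set A := fderiv ℝ G z with hA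
  set b := fderiv ℝ (fderiv ℝ G) z v v with hb
  have hid : Tendsto (fun t : ℝ => t) (𝓝[>] 0) (𝓝 0) := nhdsWithin_le_nhds
  have hpos : ∀ᶠ t : ℝ in 𝓝[>] 0, 0 < t := self_mem_nhdsWithin
  have hdir : Tendsto (fun t : ℝ => v + (t / 2) • w) (𝓝[>] 0) (𝓝 v) := by
    simpa using ((hid.div_const 2).smul_const w).const_add v
  have hz : Tendsto (fun t : ℝ => z + t • (v + (t / 2) • w)) (𝓝[>] 0) (𝓝 z) := by
    simpa using (hid.smul hdir).const_add z
  have hR := hs.contDiffAt.tendsto_second_order_quotient hpos hid hdir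
  have hlim : Tendsto (fun t : ℝ => ‖(t ^ 2)⁻¹ • (G (z + t • (v + (t / 2) • w)) - G z -
      t • A (v + (t / 2) • w)) + (1 / 2 : ℝ) • (A w - k)‖) (𝓝[>] 0)
      (𝓝 ‖(1 / 2 : ℝ) • b + (1 / 2 : ℝ) • (A w - k)‖) := (hR.add_const _).norm
  have hlt : ‖(1 / 2 : ℝ) • b + (1 / 2 : ℝ) • (A w - k)‖ < ε := by
    have : (1 / 2 : ℝ) • b + (1 / 2 : ℝ) • (A w - k) = (1 / 2 : ℝ) • (A w + b - k) := by module
    rw [this, norm_smul, Real.norm_of_nonneg (by norm_num)]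
    linarith
  filter_upwards [hz.eventually hnear, hlim.eventually (gt_mem_nhds hlt), hpos] with t h1 h2 ht
  -- This element of K matches the second-order expansion of G at the trial point up to t²ε.
  obtain ⟨x, hx, hle⟩ := h1 (t • A v + (t ^ 2 / 2) • k)
    (K.add_mem (K.smul_mem hv ht.le) (K.smul_mem hk (by positivity))) (t ^ 2 * ε) (by positivity)
  refine ⟨x, hx, hle.trans ?_⟩
  have h3 : ∀ e : E, e - (t • A v + (t ^ 2 / 2) • k) =
      t ^ 2 • ((t ^ 2)⁻¹ • (e - G z - t • A (v + (t / 2) • w)) + (1 / 2 : ℝ) • (A w - k)) := by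
    intro e
    rw [smul_add, smul_smul, mul_inv_cancel₀ (pow_pos ht 2).ne', hs.map_eq_zero, map_add, map_smul]
    module
  have h4 : ‖G (z + t • (v + (t / 2) • w)) - (t • A v + (t ^ 2 / 2) • k)‖ ≤ t ^ 2 * ε := by
    rw [h3, norm_smul, Real.norm_of_nonneg (by positivity)]
    gcongr
  calc κ * ‖G (z + t • (v + (t / 2) • w)) - (t • A v + (t ^ 2 / 2) • k)‖ + t ^ 2 * ε
      ≤ κ * (t ^ 2 * ε) + t ^ 2 * ε := by gcongr
    _ = t ^ 2 * ((κ + 1) * ε) := by ring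

/-- Minimizers of the regularized problem over the solution set, written as
`z.2 + t • (v.2 + d)`: they satisfy the constraint, have small objective, and carry normals. -/
theorem IsStableConicSystem.exists_minimizer [FiniteDimensional ℝ X]
    (hs : IsStableConicSystem Γ G K z) {κ : ℝ}
    (hκ : 0 ≤ κ) (hnear : ∀ᶠ y in 𝓝 z, ∀ k ∈ K, ∀ ε > 0,
      ∃ x ∈ Γ y.1, ‖x - y.2‖ ≤ κ * ‖G y - k‖ + ε)
    {δ : ℝ} (hδ : 0 < δ) (hδG : ∀ y ∈ Metric.closedBall z δ, ContinuousAt G y)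
    (hδΓ : ∀ y ∈ Metric.closedBall z δ, y.2 ∈ Γ y.1 ↔ G y ∈ K)
    {v w : P × X} {k : E} (hk : k ∈ K) {ε : ℝ} (hε : 0 < ε) (hv : fderiv ℝ G z v ∈ K)
    (hw : ‖fderiv ℝ G z w + fderiv ℝ (fderiv ℝ G) z v v - k‖ < ε)
    (xs us : StrongDual ℝ X) {ρ : ℝ} (hρ : 0 < ρ) :
    ∃ D : ℝ, ∀ᶠ t in 𝓝[>] (0 : ℝ), ∃ d : X,
      z + t • (v.1 + (t / 2) • w.1, v.2 + d) ∈ Metric.closedBall z δ ∧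
      G (z + t • (v.1 + (t / 2) • w.1, v.2 + d)) ∈ K ∧
      -(xs d / t) - us d + ρ / 2 * ‖d‖ ^ 2 ≤ -(xs w.2 / 2) + ‖xs‖ * ((κ + 1) * ε) + t * D ∧
      (‖t • (v.2 + d)‖ < δ → xs + t • (us - ρ • innerSL ℝ d) ∈
        regularNormalCone (Γ (z.1 + t • (v.1 + (t / 2) • w.1))) (z.2 + t • (v.2 + d))) := by
  set D₀ := ‖w.2‖ + (κ + 1) * ε with hD₀
  have hD₀nn : 0 ≤ D₀ := by positivity
  refine ⟨‖us‖ * D₀ + ρ / 2 * D₀ ^ 2, ?_⟩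
  have hid : Tendsto (fun t : ℝ => t) (𝓝[>] 0) (𝓝 0) := nhdsWithin_le_nhds
  have hpos : ∀ᶠ t : ℝ in 𝓝[>] 0, 0 < t := self_mem_nhdsWithin
  have hp : Tendsto (fun t : ℝ => t • (v.1 + (t / 2) • w.1)) (𝓝[>] 0) (𝓝 0) := by
    simpa using hid.smul (((hid.div_const 2).smul_const w.1).const_add v.1)
  have hb : Tendsto (fun t : ℝ => t * (‖v.2‖ + t * D₀)) (𝓝[>] 0) (𝓝 0) := by
    simpa using hid.mul ((hid.mul_const D₀).const_add ‖v.2‖)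
  filter_upwards [hs.exists_recovery hκ hnear hk hε hv hw, hpos, hid.eventually (gt_mem_nhds one_pos),
    hp.norm.eventually (gt_mem_nhds (by simpa using hδ)), hb.eventually (gt_mem_nhds hδ)]
    with t ⟨x', hx'Γ, hx'⟩ ht ht1 hpδ hbδ
  set p := z.1 + t • (v.1 + (t / 2) • w.1) with hpdef
  set c := z.2 + t • v.2 with hc
  have hmem : ∀ x ∈ Metric.closedBall z.2 δ, ((p, x) : P × X) ∈ Metric.closedBall z δ := by
    intro x hx
    rw [Metric.mem_closedBall, Prod.dist_eq, max_le_iff]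
    refine ⟨?_, hx⟩
    rw [dist_eq_norm, hpdef, add_sub_cancel_left]
    exact hpδ.le
  -- The ball provides compactness. A normal to Γ(p) itself results only if the minimizer is
  -- interior to it, whence the condition in the last conclusion.
  set S : Set X := Metric.closedBall z.2 δ ∩ Γ p with hS
  have hScomp : IsCompact S := by
    have hSeq : S = Metric.closedBall z.2 δ ∩ (fun x => G (p, x)) ⁻¹' K := by
      ext x
      exact and_congr_right fun hx => hδΓ _ (hmem x hx)
    have hcont : ContinuousOn (fun x => G (p, x)) (Metric.closedBall z.2 δ) := fun x hx =>
      ((hδG _ (hmem x hx)).comp (f := fun x => (p, x)) (by fun_prop)).continuousWithinAt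
    have : ProperSpace X := FiniteDimensional.proper ℝ _
    refine (isCompact_closedBall z.2 δ).of_isClosed_subset ?_ inter_subset_left
    rw [hSeq]
    exact hcont.preimage_isClosed_of_isClosed Metric.isClosed_closedBall K.isClosed
  set d' := t⁻¹ • (x' - c) with hd'
  have hx'c : x' - c = t • d' := by rw [hd', smul_smul, mul_inv_cancel₀ ht.ne', one_smul]
  have hd'w : ‖d' - (t / 2) • w.2‖ ≤ t * ((κ + 1) * ε) := by
    have h1 : x' - (z.2 + t • (v.2 + (t / 2) • w.2)) = t • (d' - (t / 2) • w.2) := by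
      rw [smul_sub, ← hx'c, hc]
      module
    rw [h1, norm_smul, Real.norm_of_nonneg ht.le] at hx'
    refine le_of_mul_le_mul_left ?_ ht
    linarith
  have hd'le : ‖d'‖ ≤ t * D₀ := by
    calc ‖d'‖ = ‖(d' - (t / 2) • w.2) + (t / 2) • w.2‖ := by rw [sub_add_cancel]
      _ ≤ t * ((κ + 1) * ε) + t / 2 * ‖w.2‖ := by
        refine (norm_add_le _ _).trans ?_
        rw [norm_smul, Real.norm_of_nonneg (by positivity : 0 ≤ t / 2)]
        gcongr
      _ ≤ _ := by
        rw [hD₀]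
        nlinarith [norm_nonneg w.2]
  have hx'S : x' ∈ S := by
    refine ⟨?_, hx'Γ⟩
    rw [Metric.mem_closedBall, dist_eq_norm]
    have h1 : x' - z.2 = t • (v.2 + d') := by rw [smul_add, ← hx'c, hc]; abel
    rw [h1, norm_smul, Real.norm_of_nonneg ht.le]
    refine le_trans ?_ hbδ.le
    gcongr
    exact (norm_add_le _ _).trans (by gcongr)
  set l := xs + t • us with hl
  obtain ⟨x, hxS, hxmin⟩ := hScomp.exists_isMinOn (f := fun y => -l (y - c) + ρ / 2 * ‖y - c‖ ^ 2)
    ⟨x', hx'S⟩ (by fun_prop)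
  set d := t⁻¹ • (x - c) with hd
  have hxc : x - c = t • d := by rw [hd, smul_smul, mul_inv_cancel₀ ht.ne', one_smul]
  have hxeq : z.2 + t • (v.2 + d) = x := by rw [smul_add, ← hxc, hc]; abel
  have hzeq : z + t • ((v.1 + (t / 2) • w.1, v.2 + d) : P × X) = (p, x) :=
    Prod.ext rfl hxeq
  refine ⟨d, by rw [hzeq]; exact hmem x hxS.1, by rw [hzeq]; exact (hδΓ _ (hmem x hxS.1)).1 hxS.2,
    ?_, fun hlt => ?_⟩
  · have h1 := hxmin hx'S
    simp only [mem_ofPred_eq, hxc, hx'c] at h1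
    -- After the substitution x = c + te the objective is t² times the rescaled one; it is compared
    -- with the recovered point, whose displacement d' is close to (t/2)w.2.
    have hobj : ∀ e : X, -l (t • e) + ρ / 2 * ‖t • e‖ ^ 2 =
        t ^ 2 * (-(xs e / t) - us e + ρ / 2 * ‖e‖ ^ 2) := by
      intro e
      rw [norm_smul, Real.norm_of_nonneg ht.le]
      simp only [hl, add_apply, smul_apply, map_smul, smul_eq_mul]
      field_simp
      ring
    rw [hobj, hobj] at h1
    have h2 := le_of_mul_le_mul_left h1 (by positivity)
    refine h2.trans ?_
    have h3 : -(xs d' / t) ≤ -(xs w.2 / 2) + ‖xs‖ * ((κ + 1) * ε) := by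
      have h4 : -xs (d' - (t / 2) • w.2) ≤ ‖xs‖ * (t * ((κ + 1) * ε)) := by
        refine (neg_le_abs _).trans ((xs.le_opNorm _).trans ?_)
        gcongr
      rw [map_sub, map_smul xs (t / 2) w.2, smul_eq_mul] at h4
      rw [neg_le_iff_add_nonneg, ← sub_nonneg]
      have h5 : 0 ≤ (‖xs‖ * (t * ((κ + 1) * ε)) + (xs d' - t / 2 * xs w.2)) / t :=
        div_nonneg (by linarith) ht.le
      refine h5.trans (le_of_eq ?_)
      field_simp
      ring
    have h4 : -us d' ≤ t * (‖us‖ * D₀) := by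
      refine (neg_le_abs _).trans ((us.le_opNorm _).trans ?_)
      calc ‖us‖ * ‖d'‖ ≤ ‖us‖ * (t * D₀) := by gcongr
        _ = _ := by ring
    have h5 : ρ / 2 * ‖d'‖ ^ 2 ≤ t * (ρ / 2 * D₀ ^ 2) := by
      calc ρ / 2 * ‖d'‖ ^ 2 ≤ ρ / 2 * (t * D₀) ^ 2 := by gcongr
        _ = t * (t * (ρ / 2 * D₀ ^ 2)) := by ring
        _ ≤ t * (1 * (ρ / 2 * D₀ ^ 2)) := by gcongr
        _ = _ := by ring
    linarith
  · rw [hxeq]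
    have h1 : xs + t • (us - ρ • innerSL ℝ d) = l - ρ • innerSL ℝ (x - c) := by
      have h2 : innerSL ℝ (x - c) = t • innerSL ℝ d := by
        ext y
        simp [hxc]
      rw [h2, hl]
      module
    rw [h1]
    refine mem_regularNormalCone_of_isMinOn hρ hxS.2 ?_
    have hball : x ∈ Metric.ball z.2 δ := by
      rw [Metric.mem_ball, dist_eq_norm, ← hxeq, add_sub_cancel_left]
      exact hlt
    filter_upwards [nhdsWithin_le_nhds (Metric.isOpen_ball.mem_nhds hball), self_mem_nhdsWithin]
      with y hy hyΓ
    exact hxmin ⟨Metric.ball_subset_closedBall hy, hyΓ⟩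

end LowerEstimate

section LowerEstimate

variable {P X E : Type*} [NormedAddCommGroup P] [NormedSpace ℝ P]
  [NormedAddCommGroup X] [InnerProductSpace ℝ X]
  [NormedAddCommGroup E] [InnerProductSpace ℝ E]
  {Γ : P → Set X} {G : P × X → E} {K : ProperCone ℝ E} {z : P × X}

theorem le_add_one_of_sq_le {a b c : ℝ} (hb : 0 ≤ b) (hc : 0 ≤ c)
    (h : a ^ 2 ≤ b + c * a) : a ≤ b + c + 1 := by
  by_contra! hlt
  nlinarith

/-- The regularized problems produce tangents to the graph of the normal cone mapping whose
distance to the prescribed direction is controlled by the duality gap `ε`. -/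
theorem IsStableConicSystem.exists_approx_tangent [FiniteDimensional ℝ X]
    (hs : IsStableConicSystem Γ G K z) {N : NormalConeKind} {v : P × X} {xs us : StrongDual ℝ X}
    (hxs : xs ∈ normalCone N (Γ z.1) z.2) {μ₀ : StrongDual ℝ E}
    (hμ₀ : μ₀ ∈ polarCone (K : Set E)) (hv : fderiv ℝ G z v ∈ K) (hv0 : μ₀ (fderiv ℝ G z v) = 0)
    (hμxs : ∀ u, μ₀ (fderiv ℝ G z (0, u)) = xs u)
    (hmax : ∀ μ' ∈ polarCone (K : Set E), μ'.comp (fderiv ℝ G z) = μ₀.comp (fderiv ℝ G z) →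
      μ' (fderiv ℝ (fderiv ℝ G) z v v) ≤ μ₀ (fderiv ℝ (fderiv ℝ G) z v v))
    {ws : StrongDual ℝ (P × X)}
    (hws : ∀ y, fderiv ℝ G z y ∈ K → μ₀ (fderiv ℝ G z y) = 0 → ws y ≤ 0) (hwsv : ws v = 0)
    (hus : ∀ u, us u = μ₀ (fderiv ℝ (fderiv ℝ G) z v (0, u)) + ws (0, u)) :
    ∃ C ρ : ℝ, 0 ≤ C ∧ ∀ ε > 0, ∃ d : X, ‖d‖ ^ 2 ≤ C * ε ∧
      ((v.1, v.2 + d), us - ρ • innerSL ℝ d) ∈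
        bouligandTangentCone (setValuedGraph (normalConeMapping N Γ)) (z, xs) := by
  obtain ⟨κ, hκ, hnear⟩ := hs.exists_near
  obtain ⟨M, hM, hcrude, hMH⟩ := hs.contDiffAt.exists_eventually_norm_sub_le_sq
  set A := fderiv ℝ G z with hA
  set H := fderiv ℝ (fderiv ℝ G) z with hH
  have hsym : IsSymmSndFDerivAt ℝ G z := hs.contDiffAt.isSymmSndFDerivAt (by simp)
  set M' := ‖μ₀‖ * M with hM'
  have hM'nn : 0 ≤ M' := by positivity
  -- Chosen so that ρ/2 − 2M' = 1: the regularization dominates the curvature of the constraint,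
  -- independently of ε.
  set ρ := 4 * M' + 2 with hρ
  have hρpos : 0 < ρ := by positivity
  refine ⟨‖xs‖ * (κ + 1) + 1 / 2, ρ, by positivity, fun ε hε => ?_⟩
  obtain ⟨δ', hδ', hball⟩ := Metric.eventually_nhds_iff_ball.1
    ((hs.contDiffAt.eventually (by simp)).and (hs.mem_iff.and hcrude))
  set δ := δ' / 2 with hδ
  have hδpos : 0 < δ := by positivity
  have hsub : ∀ y ∈ Metric.closedBall z δ, y ∈ Metric.ball z δ' := fun y hy =>
    Metric.closedBall_subset_ball (half_lt_self hδ') hy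
  obtain ⟨w, k, hk, hwk, hwopt⟩ := exists_approx_dual_solution K A (H v v) hμ₀ hmax hε
  obtain ⟨D, hD⟩ := hs.exists_minimizer hκ hnear hδpos
    (fun y hy => (hball y (hsub y hy)).1.continuousAt) (fun y hy => (hball y (hsub y hy)).2.1)
    hk hε hv hwk xs us hρpos
  obtain ⟨t, d, ht, ht0, hQ⟩ := exists_seq_of_eventually_nhdsGT
    ((hD.and (nhdsWithin_le_nhds (gt_mem_nhds one_pos))).mono fun t h =>
      h.1.imp fun d hd => And.intro hd h.2)
  set vn : ℕ → P × X := fun n => (v.1 + (t n / 2) • w.1, v.2 + d n) with hvn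
  have hvn_eq : ∀ n, vn n = v + (t n / 2) • (w.1, 0) + (0, d n) := fun n => by
    ext <;> simp [hvn]
  have hAvn : ∀ n, μ₀ (A (vn n)) = t n / 2 * μ₀ (A (w.1, 0)) + xs (d n) := fun n => by
    rw [hvn_eq, map_add, map_add, map_add, map_add, hv0, hμxs, map_smul, map_smul, smul_eq_mul,
      zero_add]
  have hGK : ∀ n, G (z + t n • vn n) ∈ K := fun n => (hQ n).1.2.1
  have hμG : ∀ n, μ₀ (G (z + t n • vn n)) ≤ 0 := fun n => hμ₀ _ (hGK n)
  set a := μ₀ (A (w.1, 0)) with ha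
  have hobj : ∀ n, -(xs (d n) / t n) - us (d n) + ρ / 2 * ‖d n‖ ^ 2 ≤
    -(xs w.2 / 2) + ‖xs‖ * ((κ + 1) * ε) + t n * D := fun n => (hQ n).1.2.2.1
  set B := |(-(xs w.2 / 2) + ‖xs‖ * ((κ + 1) * ε))| + |D| with hB
  have hobjB : ∀ n, -(xs (d n) / t n) - us (d n) + ρ / 2 * ‖d n‖ ^ 2 ≤ B := fun n => by
    refine (hobj n).trans (add_le_add (le_abs_self _) ?_)
    calc t n * D ≤ t n * |D| := mul_le_mul_of_nonneg_left (le_abs_self D) (ht n).le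
      _ ≤ 1 * |D| := mul_le_mul_of_nonneg_right (hQ n).2.le (abs_nonneg D)
      _ = |D| := one_mul _
  set V := ‖v‖ + ‖w.1‖ with hV
  have hvn_le : ∀ n, ‖vn n‖ ≤ V + ‖d n‖ := fun n => by
    rw [hvn_eq]
    refine (norm_add₃_le).trans ?_
    have h1 : ‖((0, d n) : P × X)‖ = ‖d n‖ := by simp [Prod.norm_mk]
    have h2 : ‖(t n / 2) • ((w.1, 0) : P × X)‖ ≤ ‖w.1‖ := by
      have h3 : ‖((w.1, 0) : P × X)‖ = ‖w.1‖ := by simp [Prod.norm_mk]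
      have ht2 : 0 ≤ t n / 2 := by have := ht n; positivity
      rw [norm_smul, h3, Real.norm_of_nonneg ht2]
      have : t n / 2 ≤ 1 := by have := (hQ n).2; linarith
      exact mul_le_of_le_one_left (norm_nonneg _) this
    rw [h1, hV]
    linarith
  -- Feasibility gives μ₀(G) ≤ 0, and expanding G bounds the term that the objective might exploit
  -- as t ↓ 0.
  have hxs_le : ∀ n, xs (d n) / t n ≤ M' * ‖vn n‖ ^ 2 + |a| := fun n => by
    have htn := ht n
    have h1 := (hball _ (hsub _ (hQ n).1.1)).2.2
    rw [hs.map_eq_zero, sub_zero, add_sub_cancel_left] at h1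
    change ‖G (z + t n • vn n) - A (t n • vn n)‖ ≤ M * ‖t n • vn n‖ ^ 2 at h1
    rw [norm_smul, Real.norm_of_nonneg htn.le, map_smul] at h1
    have h2 : -μ₀ (G (z + t n • vn n) - t n • A (vn n)) ≤ M' * (t n * ‖vn n‖) ^ 2 := by
      refine (neg_le_abs _).trans ((μ₀.le_opNorm _).trans ?_)
      calc ‖μ₀‖ * ‖G (z + t n • vn n) - t n • A (vn n)‖ ≤ ‖μ₀‖ * (M * (t n * ‖vn n‖) ^ 2) := by
            gcongr
        _ = _ := by ring
    rw [map_sub, map_smul, smul_eq_mul, hAvn] at h2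
    have h3 := hμG n
    have h4 : t n * xs (d n) ≤ t n ^ 2 * (M' * ‖vn n‖ ^ 2 + |a|) := by
      have h5 : -(t n ^ 2 * a) ≤ t n ^ 2 * |a| := by
        rw [← mul_neg]
        exact mul_le_mul_of_nonneg_left (neg_le_abs a) (by positivity)
      have h6 : 0 ≤ t n ^ 2 * |a| := by positivity
      nlinarith
    rw [div_le_iff₀ htn]
    refine le_of_mul_le_mul_left (h4.trans (le_of_eq ?_)) htn
    ring
  have hdbdd : ∀ n, ‖d n‖ ≤ (B + |a| + 2 * M' * V ^ 2) + ‖us‖ + 1 := fun n => by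
    refine le_add_one_of_sq_le (by positivity) (norm_nonneg _) ?_
    have h1 := hobjB n
    have h2 := hxs_le n
    have h3 : us (d n) ≤ ‖us‖ * ‖d n‖ := (le_abs_self _).trans (us.le_opNorm _)
    have h4 : ‖vn n‖ ^ 2 ≤ 2 * V ^ 2 + 2 * ‖d n‖ ^ 2 := by
      have h5 : ‖vn n‖ ^ 2 ≤ (V + ‖d n‖) ^ 2 := by
        gcongr
        exact hvn_le n
      nlinarith [sq_nonneg (V - ‖d n‖)]
    have h6 : M' * ‖vn n‖ ^ 2 ≤ M' * (2 * V ^ 2 + 2 * ‖d n‖ ^ 2) := by gcongr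
    rw [hρ] at h1
    linarith
  have : ProperSpace X := FiniteDimensional.proper ℝ _
  obtain ⟨d₀, -, φ, hφ, hdlim⟩ := tendsto_subseq_of_bounded
    (Metric.isBounded_closedBall (x := (0 : X))) (x := d)
    (fun n => mem_closedBall_zero_iff.2 (hdbdd n))
  have htlim : Tendsto (fun n => t (φ n)) atTop (𝓝 0) := ht0.comp hφ.tendsto_atTop
  replace hdlim : Tendsto (fun n => d (φ n)) atTop (𝓝 d₀) := hdlim
  have hvlim : Tendsto (fun n => vn (φ n)) atTop (𝓝 (v.1, v.2 + d₀)) := by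
    refine Tendsto.prodMk_nhds ?_ (hdlim.const_add v.2)
    simpa using ((htlim.div_const 2).smul_const w.1).const_add v.1
  have hv₀eq : ((v.1, v.2 + d₀) : P × X) = v + (0, d₀) := by ext <;> simp
  have hAv₀ : A (v.1, v.2 + d₀) ∈ K :=
    hs.fderiv_mem_of_tendsto (fun n => ht (φ n)) htlim hvlim (.of_forall fun n => hGK (φ n))
  have hμAv₀ : μ₀ (A (v.1, v.2 + d₀)) = xs d₀ := by
    rw [hv₀eq, map_add, map_add, hv0, hμxs, zero_add]
  have husd : Tendsto (fun n => us (d (φ n))) atTop (𝓝 (us d₀)) := (us.continuous.tendsto _).comp hdlim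
  have hxsd : Tendsto (fun n => xs (d (φ n))) atTop (𝓝 (xs d₀)) := (xs.continuous.tendsto _).comp hdlim
  have hnd : Tendsto (fun n => ρ / 2 * ‖d (φ n)‖ ^ 2) atTop (𝓝 (ρ / 2 * ‖d₀‖ ^ 2)) :=
    (hdlim.norm.pow 2).const_mul _
  -- Polarity gives ≤, as A(v + (0, d₀)) ∈ K. The objective bound keeps xs(d)/t bounded below, which
  -- gives ≥. Thus v + (0, d₀) is critical and `hws` applies to it.
  have hxsd₀ : xs d₀ = 0 := by
    refine le_antisymm (hμAv₀ ▸ hμ₀ _ hAv₀) ?_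
    have h1 : Tendsto (fun n => t (φ n) * (-us (d (φ n)) + ρ / 2 * ‖d (φ n)‖ ^ 2 - B)) atTop
        (𝓝 0) := by
      simpa using htlim.mul ((husd.neg.add hnd).sub_const B)
    refine le_of_tendsto_of_tendsto' h1 hxsd fun n => ?_
    have h2 := hobjB (φ n)
    have h3 : -us (d (φ n)) + ρ / 2 * ‖d (φ n)‖ ^ 2 - B ≤ xs (d (φ n)) / t (φ n) := by linarith
    rwa [le_div_iff₀ (ht (φ n)), mul_comm] at h3
  have hwsd : ws (0, d₀) ≤ 0 := by
    have := hws _ hAv₀ (by rw [hμAv₀, hxsd₀])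
    rwa [hv₀eq, map_add, hwsv, zero_add] at this
  -- The limit of the objective inequality, with −xs(d)/t replaced by its second-order lower bound
  -- from μ₀(G) ≤ 0.
  have hquad : μ₀ ((1 / 2 : ℝ) • H (v.1, v.2 + d₀) (v.1, v.2 + d₀)) + a / 2 + xs w.2 / 2 -
      us d₀ + ρ / 2 * ‖d₀‖ ^ 2 ≤ ‖xs‖ * ((κ + 1) * ε) := by
    have hR := hs.contDiffAt.tendsto_second_order_quotient (.of_forall fun n => ht (φ n)) htlim hvlim
    have h1 := ((((μ₀.continuous.tendsto _).comp hR).add_const (a / 2 + xs w.2 / 2)).sub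
      husd).add hnd
    have h2 : Tendsto (fun n => ‖xs‖ * ((κ + 1) * ε) + t (φ n) * D) atTop
        (𝓝 (‖xs‖ * ((κ + 1) * ε))) := by
      simpa using (htlim.mul_const D).const_add (‖xs‖ * ((κ + 1) * ε))
    rw [← add_assoc] at h1
    refine le_of_tendsto_of_tendsto' h1 h2 fun n => ?_
    have htn := ht (φ n)
    have h3 := hobj (φ n)
    have h4 : μ₀ ((t (φ n) ^ 2)⁻¹ • (G (z + t (φ n) • vn (φ n)) - G z -
        t (φ n) • A (vn (φ n)))) ≤ -(a / 2) - xs (d (φ n)) / t (φ n) := by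
      have h5 : -(a / 2) - xs (d (φ n)) / t (φ n) =
          (t (φ n) ^ 2)⁻¹ * (0 - t (φ n) * μ₀ (A (vn (φ n)))) := by
        rw [hAvn]
        field_simp
        ring
      rw [h5, map_smul, map_sub, map_sub, map_smul, hs.map_eq_zero, map_zero, smul_eq_mul,
        smul_eq_mul, sub_zero]
      gcongr
      exact hμG _
    simp only [Function.comp]
    linarith
  have hexp : H (v.1, v.2 + d₀) (v.1, v.2 + d₀) =
      H v v + (2 : ℝ) • H v (0, d₀) + H (0, d₀) (0, d₀) := by
    have h1 : H (0, d₀) v = H v (0, d₀) := hsym _ _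
    rw [hv₀eq]
    simp only [map_add, add_apply, h1]
    module
  have hH0 : -μ₀ (H (0, d₀) (0, d₀)) ≤ M' * ‖d₀‖ ^ 2 := by
    have hn : ‖((0, d₀) : P × X)‖ = ‖d₀‖ := by simp [Prod.norm_mk]
    refine (neg_le_abs _).trans ((μ₀.le_opNorm _).trans ?_)
    have h1 := hMH (0, d₀)
    rw [hn] at h1
    calc ‖μ₀‖ * ‖H (0, d₀) (0, d₀)‖ ≤ ‖μ₀‖ * (M * ‖d₀‖ ^ 2) := by gcongr
      _ = _ := by ring
  refine ⟨d₀, ?_, ?_⟩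
  -- In the expanded `hquad` the mixed second-order term cancels against `us d₀`, the leftover
  -- −ws(0, d₀) is nonnegative, and the value terms at v and w sum to at least −ε/2. What remains is
  -- a multiple of ‖d₀‖² that is at least ‖d₀‖².
  · have hAw : μ₀ (A w) = a + xs w.2 := by
      have : w = (w.1, 0) + (0, w.2) := by simp
      conv_lhs => rw [this]
      rw [map_add, map_add, hμxs]
    rw [hAw] at hwopt
    rw [hexp, hus] at hquad
    simp only [map_smul, map_add, smul_eq_mul] at hquad
    rw [hρ] at hquad
    have h7 : 0 ≤ M' * ‖d₀‖ ^ 2 := by positivity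
    linarith
  · refine mem_bouligandTangentCone_iff.2 ⟨hxs, fun η hη => ?_⟩
    have h1 : Tendsto (fun n => ‖t (φ n) • (v.2 + d (φ n))‖) atTop (𝓝 0) := by
      simpa using (htlim.smul (hdlim.const_add v.2)).norm
    have h2 : Tendsto (fun n => ((vn (φ n), us - ρ • innerSL ℝ (d (φ n))) :
        (P × X) × StrongDual ℝ X)) atTop (𝓝 ((v.1, v.2 + d₀), us - ρ • innerSL ℝ d₀)) :=
      hvlim.prodMk_nhds (((((innerSL ℝ).continuous.tendsto d₀).comp hdlim).const_smul ρ).const_sub us)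
    obtain ⟨n, hn1, hn2, hn3⟩ := ((h1.eventually (gt_mem_nhds hδpos)).and
      ((htlim.eventually (gt_mem_nhds hη)).and (Metric.tendsto_nhds.1 h2 η hη))).exists
    refine ⟨t (φ n), ht (φ n), hn2, _, by rwa [dist_eq_norm] at hn3, ?_⟩
    exact regularNormalCone_subset_normalCone N _ _ ((hQ (φ n)).1.2.2.2 hn1)

/-- The lower estimate of the tangent cone to the graph of the normal cone mapping. -/
theorem IsStableConicSystem.mem_tangentCone [FiniteDimensional ℝ X]
    (hs : IsStableConicSystem Γ G K z) {N : NormalConeKind} {v : P × X} {xs us : StrongDual ℝ X}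
    (hxs : xs ∈ normalCone N (Γ z.1) z.2) {μ₀ : StrongDual ℝ E}
    (hμ₀ : μ₀ ∈ polarCone (K : Set E)) (hv : fderiv ℝ G z v ∈ K) (hv0 : μ₀ (fderiv ℝ G z v) = 0)
    (hμxs : ∀ u, μ₀ (fderiv ℝ G z (0, u)) = xs u)
    (hmax : ∀ μ' ∈ polarCone (K : Set E), μ'.comp (fderiv ℝ G z) = μ₀.comp (fderiv ℝ G z) →
      μ' (fderiv ℝ (fderiv ℝ G) z v v) ≤ μ₀ (fderiv ℝ (fderiv ℝ G) z v v))
    {ws : StrongDual ℝ (P × X)}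
    (hws : ∀ y, fderiv ℝ G z y ∈ K → μ₀ (fderiv ℝ G z y) = 0 → ws y ≤ 0) (hwsv : ws v = 0)
    (hus : ∀ u, us u = μ₀ (fderiv ℝ (fderiv ℝ G) z v (0, u)) + ws (0, u)) :
    (v, us) ∈ bouligandTangentCone (setValuedGraph (normalConeMapping N Γ)) (z, xs) := by
  obtain ⟨C, ρ, hC, h⟩ := hs.exists_approx_tangent hxs hμ₀ hv hv0 hμxs hmax hws hwsv hus
  choose d hd hmem using fun n : ℕ => h (1 / (n + 1)) Nat.one_div_pos_of_nat
  have h0 : Tendsto (fun n : ℕ => C * (1 / ((n : ℝ) + 1))) atTop (𝓝 0) := by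
    simpa using (tendsto_one_div_add_atTop_nhds_zero_nat (𝕜 := ℝ)).const_mul C
  have hd0 : Tendsto d atTop (𝓝 0) := by
    rw [tendsto_zero_iff_norm_tendsto_zero]
    have := (squeeze_zero (fun n => by positivity) hd h0).sqrt
    simpa [Real.sqrt_sq] using this
  have hlim : Tendsto (fun n => (((v.1, v.2 + d n), us - ρ • innerSL ℝ (d n)) :
      (P × X) × StrongDual ℝ X)) atTop (𝓝 (v, us)) := by
    have h1 : Continuous fun e : X => (((v.1, v.2 + e), us - ρ • innerSL ℝ e) :
      (P × X) × StrongDual ℝ X) := by fun_prop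
    simpa [Function.comp_def] using (h1.tendsto 0).comp hd0
  exact (isClosed_bouligandTangentCone _ _).mem_of_tendsto hlim (.of_forall hmem)

end LowerEstimate

/-! ### Reduction of the original system, and assembly of the formula. -/

section StableSystem

variable {P X E : Type*} [NormedAddCommGroup P] [NormedSpace ℝ P]
  [NormedAddCommGroup X] [NormedSpace ℝ X]
  [NormedAddCommGroup E] [InnerProductSpace ℝ E]
  {Γ : P → Set X} {G : P × X → E} {K : ProperCone ℝ E} {z : P × X}

theorem IsStableConicSystem.fderiv_partialXAdjoint_apply (hs : IsStableConicSystem Γ G K z)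
    (μ : StrongDual ℝ E) (v : P × X) :
    fderiv ℝ (partialXAdjoint G μ) z v =
      (μ.comp (fderiv ℝ (fderiv ℝ G) z v)).comp (ContinuousLinearMap.inr ℝ P X) := by
  set Φ : (P × X →L[ℝ] E) →L[ℝ] StrongDual ℝ X := (ContinuousLinearMap.compL ℝ X E ℝ μ).comp
    ((ContinuousLinearMap.compL ℝ X (P × X) E).flip (ContinuousLinearMap.inr ℝ P X)) with hΦ
  have heq : partialXAdjoint G μ =ᶠ[𝓝 z] fun y => Φ (fderiv ℝ G y) := by
    filter_upwards [hs.contDiffAt.eventually (by simp)] with y hy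
    have h1 := (hy.differentiableAt (by simp)).hasFDerivAt.comp_prodMk_left
    rw [partialXAdjoint, partialX, h1.fderiv]
    rfl
  have hΦd : HasFDerivAt (fun y => Φ (fderiv ℝ G y)) (Φ.comp (fderiv ℝ (fderiv ℝ G) z)) z :=
    Φ.hasFDerivAt.comp z hs.hasFDerivAt_fderiv
  rw [heq.fderiv_eq, hΦd.fderiv]
  rfl

/-- A `C²`-reducible constraint system whose reduction is Robinson stable is a stable conic
system. -/
theorem isStableConicSystem_of_robinsonStable {Y : Type*} [NormedAddCommGroup Y] [NormedSpace ℝ Y]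
    {g : P × X → Y} {C : Set Y} {V : Set Y} {h : Y → E} (hg : ContDiffAt ℝ 2 g z)
    (hC : IsC2ConeReduction C (g z) K V h) (hRS : RobinsonStable (h ∘ g) (K : Set E) z) :
    IsStableConicSystem (solutionMap g C) (h ∘ g) K z := by
  have hV : V ∈ 𝓝 (g z) := hC.isOpen_nhd.mem_nhds hC.mem_nhd
  have hC2 : ContDiffAt ℝ 2 (h ∘ g) z := (hC.contDiffOn.contDiffAt hV).comp z hg
  have hG0 : (h ∘ g) z = 0 := hC.map_eq_zero
  have hmem : ∀ᶠ y in 𝓝 z, y.2 ∈ solutionMap g C y.1 ↔ (h ∘ g) y ∈ K := by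
    filter_upwards [hg.continuousAt.eventually hV] with y hy
    have h1 : g y ∈ C ∩ V ↔ g y ∈ {y' ∈ V | h y' ∈ K} := by rw [hC.inter_eq]
    exact ⟨fun h2 => (h1.1 ⟨h2, hy⟩).2, fun h2 => (h1.2 ⟨hy, h2⟩).1⟩
  refine ⟨hC2, hG0, hmem, ?_⟩
  obtain ⟨κ, hκ⟩ := hRS
  obtain ⟨δ, hδ, hball⟩ := Metric.eventually_nhds_iff_ball.1 hmem
  have hsmall : ∀ᶠ y in 𝓝 z, (κ : ℝ) * ‖(h ∘ g) y‖ < δ / 2 := by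
    have h1 : Tendsto (fun y => (κ : ℝ) * ‖(h ∘ g) y‖) (𝓝 z) (𝓝 0) := by
      have := hC2.continuousAt.norm.tendsto.const_mul (κ : ℝ)
      rwa [hG0, norm_zero, mul_zero] at this
    exact h1.eventually (gt_mem_nhds (by positivity))
  refine ⟨κ, κ.2, ?_⟩
  filter_upwards [hκ, hsmall, Metric.ball_mem_nhds z (half_pos hδ)] with y h1 h2 h3 k hk ε hε
  have hdist : ∀ k ∈ K, Metric.infEDist y.2 {x | (h ∘ g) (y.1, x) ∈ (K : Set E)} ≤
      ENNReal.ofReal (κ * ‖(h ∘ g) y - k‖) := by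
    intro k hk
    refine h1.trans ?_
    rw [ENNReal.ofReal_mul κ.coe_nonneg, ENNReal.ofReal_coe_nnreal]
    gcongr
    refine (Metric.infEDist_le_edist_of_mem hk).trans ?_
    rw [edist_dist, dist_eq_norm]
  -- The bound with k = 0 keeps the nearby point within the ball where (h ∘ g)(y) ∈ K describes Γ;
  -- elsewhere the values of `h` may be meaningless.
  have hlt : Metric.infEDist y.2 {x | (h ∘ g) (y.1, x) ∈ (K : Set E)} <
      ENNReal.ofReal (min (κ * ‖(h ∘ g) y - k‖ + ε) (δ / 2)) := by
    rw [(ENNReal.ofReal_mono).map_min, lt_min_iff]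
    constructor
    · refine (hdist k hk).trans_lt ((ENNReal.ofReal_lt_ofReal_iff (by positivity)).2 ?_)
      linarith
    · refine (hdist 0 K.zero_mem).trans_lt ((ENNReal.ofReal_lt_ofReal_iff (by positivity)).2 ?_)
      rwa [sub_zero]
  obtain ⟨x, hx, hyx⟩ := Metric.infEDist_lt_iff.1 hlt
  rw [edist_dist, ENNReal.ofReal_lt_ofReal_iff (by positivity), lt_min_iff, dist_comm] at hyx
  refine ⟨x, (hball (y.1, x) ?_).2 hx, by rw [← dist_eq_norm]; exact hyx.1.le⟩
  rw [Metric.mem_ball, Prod.dist_eq, max_lt_iff] at h3 ⊢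
  refine ⟨h3.1.trans (half_lt_self hδ), ?_⟩
  calc dist x z.2 ≤ dist x y.2 + dist y.2 z.2 := dist_triangle _ _ _
    _ < δ := by linarith [hyx.2, h3.2]

/-- Normals to convex cones are the polar functionals that vanish at the reference point. -/
theorem Convex.apply_of_mem_normalCone {W : Type*} [NormedAddCommGroup W] [NormedSpace ℝ W]
    {N : NormalConeKind} {S : Set W} (hS : Convex ℝ S) (hcone : ∀ y ∈ S, ∀ r : ℝ, 0 ≤ r → r • y ∈ S)
    {v : W} {ws : StrongDual ℝ W} (h : ws ∈ normalCone N S v) :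
    ws v = 0 ∧ ∀ y ∈ S, ws y ≤ 0 := by
  have hv := mem_of_mem_normalCone h
  have h0 : ws v = 0 := by
    have h1 := hS.le_zero_of_mem_normalCone h (hcone v hv 0 le_rfl)
    have h2 := hS.le_zero_of_mem_normalCone h (hcone v hv 2 zero_le_two)
    rw [map_sub, map_smul, smul_eq_mul] at h1 h2
    linarith
  refine ⟨h0, fun y hy => ?_⟩
  have := hS.le_zero_of_mem_normalCone h hy
  rwa [map_sub, h0, sub_zero] at this

theorem IsStableConicSystem.tangentCone_eq (hs : IsStableConicSystem Γ G K z) :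
    bouligandTangentCone (setValuedGraph Γ) z = fderiv ℝ G z ⁻¹' K :=
  Set.ext fun _ => hs.mem_tangentCone_iff

theorem IsStableConicSystem.criticalCone_eq (hs : IsStableConicSystem Γ G K z)
    (zs : StrongDual ℝ (P × X)) :
    criticalCone (setValuedGraph Γ) z zs = fderiv ℝ G z ⁻¹' K ∩ {w | zs w = 0} := by
  rw [criticalCone, hs.tangentCone_eq]

theorem IsStableConicSystem.convex_preimage :
    Convex ℝ (fderiv ℝ G z ⁻¹' (K : Set E)) :=
  K.convex.linear_preimage (fderiv ℝ G z).toLinearMap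

end StableSystem

/-- The tangent cone to the graph of the normal cone mapping of a stable conic system. -/
theorem IsStableConicSystem.tangentCone_graph_normalConeMapping {P X E : Type*}
    [NormedAddCommGroup P] [NormedSpace ℝ P] [FiniteDimensional ℝ P]
    [NormedAddCommGroup X] [InnerProductSpace ℝ X] [FiniteDimensional ℝ X]
    [NormedAddCommGroup E] [InnerProductSpace ℝ E] [FiniteDimensional ℝ E]
    {Γ : P → Set X} {G : P × X → E} {K : ProperCone ℝ E} {z : P × X}
    (hs : IsStableConicSystem Γ G K z) {N : NormalConeKind} {xs : StrongDual ℝ X}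
    (hxs : xs ∈ normalCone N (Γ z.1) z.2)
    (hPK : characteristicSubspace G K z = univ ∨ IsPolyhedralSet (K : Set E)) :
    bouligandTangentCone (setValuedGraph (normalConeMapping N Γ)) (z, xs) =
      {w : (P × X) × StrongDual ℝ X |
        ∃ zs ∈ normalCone N (bouligandTangentCone (setValuedGraph Γ) z) w.1 ∩ dualProj ⁻¹' {xs},
        ∃ μ ∈ directionalMultiplierSet G (K : Set E) z zs w.1,
        ∃ ws ∈ normalCone N (criticalCone (setValuedGraph Γ) z zs) w.1,
          w.2 = fderiv ℝ (partialXAdjoint G μ) z w.1 + dualProj ws} := by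
  ext ⟨v, us⟩
  constructor
  · intro hmem
    obtain ⟨μ, hμ, hv, hv0, hμxs, hmax, ws, hws, hwsv, hη⟩ := hs.exists_of_mem_tangentCone hPK hmem
    -- The multiplier determines z* = ∇G(z)*μ, whose X-component is the given normal.
    refine ⟨μ.comp (fderiv ℝ G z), ⟨?_, hμxs⟩, μ, ⟨⟨hμ, rfl⟩, fun μ' hμ' => hmax μ' hμ'.1 hμ'.2⟩,
      ws, ?_, ?_⟩
    · refine mem_normalCone_of_forall_le N (hs.mem_tangentCone_iff.2 hv) fun y hy => ?_
      have h1 : μ (fderiv ℝ G z y) ≤ 0 := hμ _ (hs.mem_tangentCone_iff.1 hy)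
      simpa [hv0] using h1
    · refine mem_normalCone_of_forall_le N ⟨hs.mem_tangentCone_iff.2 hv, hv0⟩ fun y hy => ?_
      rw [map_sub, hwsv, sub_zero]
      exact hws y (hs.mem_tangentCone_iff.1 hy.1) hy.2
    · rw [hs.fderiv_partialXAdjoint_apply, dualProj, hη]
      exact (add_sub_cancel _ _).symm
  · rintro ⟨zs, ⟨hzs, hzsx⟩, μ, ⟨⟨hμ, hμzs⟩, hmax⟩, ws, hws, heq⟩
    rw [hs.tangentCone_eq] at hzs
    rw [hs.criticalCone_eq] at hws
    subst hμzs
    have hcone : ∀ y ∈ fderiv ℝ G z ⁻¹' (K : Set E), ∀ r : ℝ, 0 ≤ r →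
        r • y ∈ fderiv ℝ G z ⁻¹' (K : Set E) := fun y hy r hr => by
      rw [mem_preimage, map_smul]
      exact K.smul_mem hy hr
    have hv : v ∈ fderiv ℝ G z ⁻¹' (K : Set E) := mem_of_mem_normalCone hzs
    have hv0 := (convex_preimage.apply_of_mem_normalCone hcone hzs).1
    obtain ⟨hwsv, hwsle⟩ := (convex_preimage.inter
      (convex_hyperplane (μ.comp (fderiv ℝ G z)).toLinearMap.isLinear 0)).apply_of_mem_normalCone
        (fun y hy r hr => ⟨hcone y hy.1 r hr, by
          have h1 : (μ.comp (fderiv ℝ G z)) y = 0 := hy.2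
          change (μ.comp (fderiv ℝ G z)) (r • y) = 0
          rw [map_smul, h1, smul_zero]⟩) hws
    refine hs.mem_tangentCone hxs hμ hv hv0
      (fun u => congrArg (fun ν : StrongDual ℝ X => ν u) hzsx)
      (fun μ' hμ' h => hmax μ' ⟨hμ', h⟩) (fun y hy hy0 => hwsle y ⟨hy, hy0⟩) hwsv fun u => ?_
    rw [hs.fderiv_partialXAdjoint_apply] at heq
    exact congrArg (fun ν : StrongDual ℝ X => ν u) heq

theorem mainTheorem3
    {P X Y E : Type*}
    [NormedAddCommGroup P] [InnerProductSpace ℝ P] [FiniteDimensional ℝ P]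
    [NormedAddCommGroup X] [InnerProductSpace ℝ X] [FiniteDimensional ℝ X]
    [NormedAddCommGroup Y] [InnerProductSpace ℝ Y] [FiniteDimensional ℝ Y]
    [NormedAddCommGroup E] [InnerProductSpace ℝ E] [FiniteDimensional ℝ E]
    (N : NormalConeKind)
    (g : P × X → Y) (C : Set Y) (K : ProperCone ℝ E) (V : Set Y) (h : Y → E)
    (pbar : P) (xbar : X) (xsbar : StrongDual ℝ X)
    (hg : ContDiffAt ℝ 2 g (pbar, xbar))
    (hC : IsC2ConeReduction C (g (pbar, xbar)) K V h)
    (hxs : xsbar ∈ normalCone N (solutionMap g C pbar) xbar)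
    (hRS : RobinsonStable (h ∘ g) (K : Set E) (pbar, xbar))
    (hPK : characteristicSubspace (h ∘ g) K (pbar, xbar) = Set.univ ∨
      IsPolyhedralSet (K : Set E)) :
    bouligandTangentCone (setValuedGraph (normalConeMapping N (solutionMap g C)))
        ((pbar, xbar), xsbar) =
      {w : (P × X) × StrongDual ℝ X |
        ∃ zs ∈ normalCone N
            (bouligandTangentCone (setValuedGraph (solutionMap g C)) (pbar, xbar)) w.1 ∩
            dualProj ⁻¹' {xsbar},
        ∃ μ ∈ directionalMultiplierSet (h ∘ g) (K : Set E) (pbar, xbar) zs w.1,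
        ∃ ws ∈ normalCone N
            (criticalCone (setValuedGraph (solutionMap g C)) (pbar, xbar) zs) w.1,
          w.2 = fderiv ℝ (partialXAdjoint (h ∘ g) μ) (pbar, xbar) w.1 + dualProj ws} ∧
    ∀ v : P × X,
      graphicalDerivative (normalConeMapping N (solutionMap g C)) (pbar, xbar) xsbar v =
        ⋃ zs ∈ normalCone N
            (bouligandTangentCone (setValuedGraph (solutionMap g C)) (pbar, xbar)) v ∩
            dualProj ⁻¹' {xsbar},
        ⋃ μ ∈ directionalMultiplierSet (h ∘ g) (K : Set E) (pbar, xbar) zs v,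
          (fun ws => fderiv ℝ (partialXAdjoint (h ∘ g) μ) (pbar, xbar) v + dualProj ws) ''
            normalCone N
              (criticalCone (setValuedGraph (solutionMap g C)) (pbar, xbar) zs) v := by
  have hs := isStableConicSystem_of_robinsonStable hg hC hRS
  have hT := hs.tangentCone_graph_normalConeMapping hxs hPK
  refine ⟨hT, fun v => ?_⟩
  ext us
  rw [graphicalDerivative, mem_ofPred_eq, hT]
  simp only [mem_ofPred_eq, mem_iUnion, mem_image, exists_prop, eq_comm (b := us)]
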